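/- Let $M$ be a nonempty smooth manifold (Hausdorff, second countable, possibly with boundary) of dimension $m\ge 1$, let $k\ge 1$ and let $r\in\mathbb N$ be finite. Let $E^r=\mathcal C^r(M,\mathbb R^k)$ carry the weak Whitney topology (uniform convergence on compact subsets of charts of all derivatives of order at most $r$). A Borel probability measure $\mu$ on $E^r$ is called Gaussian if for all $p_1,\dots,p_j\in M$ the image of $\mu$ under $f\mapsto (f(p_1),\dots,f(p_j))\in\mathbb R^{jk}$ is a centered (possibly degenerate) Gaussian measure; let $\mathscr G(E^r)$ be the set of Gaussian measures on $E^r$ with the narrow topology. A $\mathcal C^r$ Gaussian random field (GRF) is a random element $X$ of $E^r$ whose law is in $\mathscr G(E^r)$. The covariance function of $\mu\in\mathscr G(E^r)$ is $K_\mu(p,q)=\int_{E^r} f(p)f(q)^T\,d\mu(f)$, and that of a GRF $X$ is $K_X(p,q)=\mathbb E\{X(p)X(q)^T\}$. Let $\mathcal C^{r,r}(M\times M,\mathbb R^{k\times k})$ be the space of functions with continuous partial derivatives of order at most $r$ in each of the two variables, with the topology of uniform convergence of all these mixed derivatives on compact subsets of products of charts. Then the inverse of the (injective) covariance map $\mathcal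 K^r:\mathscr G(E^r)\to\mathcal C^{r,r}(M\times M,\mathbb R^{k\times k})$, $\mu\mapsto K_\mu$, defined on the image of $\mathcal K^r$ with the subspace topology, is not continuous. Moreover, there is a sequence of $\mathcal C^r$ GRFs $X_n$ on $M$ with values in $\mathbb R^k$, defined on a common probability space, such that $K_{X_n}\to 0$ in $\mathcal C^{r,r}(M\times M,\mathbb R^{k\times k})$, but $X_n$ does not converge narrowly (in law, as random elements of $E^r$) to the zero field. -/

import Mathlib

open MeasureTheory ProbabilityTheory Filter Topology
open scoped Manifold ContDiff UniformConvergence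

noncomputable section

namespace GRF

variable {m : ℕ} {H : Type*} [TopologicalSpace H]

/-- The space `E^r = C^r(M, ℝᵏ)`, for `r` finite. -/
abbrev CrMap (I : ModelWithCorners ℝ (EuclideanSpace ℝ (Fin m)) H)
    (M : Type*) [TopologicalSpace M] [ChartedSpace H M] (k r : ℕ) :=
  C^(r : WithTop ℕ∞)⟮I, M; 𝓘(ℝ, EuclideanSpace ℝ (Fin k)), EuclideanSpace ℝ (Fin k)⟯

section Topology

variable (I : ModelWithCorners ℝ (EuclideanSpace ℝ (Fin m)) H)
  (M : Type*) [TopologicalSpace M] [ChartedSpace H M]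

/-- The weak Whitney topology on `C^r(M, ℝᵏ)`: uniform convergence of the derivatives of order
at most `r`, on every compact subset of the image of every smooth chart. -/
instance weakWhitneyTopology (k r : ℕ) : TopologicalSpace (CrMap I M k r) :=
  ⨅ (e : OpenPartialHomeomorph M H) (_ : e ∈ IsManifold.maximalAtlas I ∞ M)
    (i : ℕ) (_ : i ≤ r),
    TopologicalSpace.induced
      (fun f : CrMap I M k r =>
        UniformOnFun.ofFun {C | IsCompact C ∧ C ⊆ (e.extend I).target}
          (iteratedFDerivWithin ℝ i (f ∘ (e.extend I).symm) (e.extend I).target))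
      inferInstance

instance (k r : ℕ) : MeasurableSpace (CrMap I M k r) := borel _

instance (k r : ℕ) : BorelSpace (CrMap I M k r) := ⟨rfl⟩

end Topology

section Mixed

variable {E F : Type*} [NormedAddCommGroup E] [NormedSpace ℝ E]
  [NormedAddCommGroup F] [NormedSpace ℝ F]

/-- The mixed derivative `D₁ⁱ D₂ʲ G` of `G : S × T → F`: all partial derivatives of `G` that are
of order `i` in the first and of order `j` in the second variable. -/
def mixedDeriv (i j : ℕ) (S T : Set E) (G : E × E → F) (z : E × E) :
    E [×i]→L[ℝ] (E [×j]→L[ℝ] F) :=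
  iteratedFDerivWithin ℝ i (fun u => iteratedFDerivWithin ℝ j (fun v => G (u, v)) T z.2) S z.1

/-- `G` is of class `C^{r,r}` on `S × T`: the derivatives of order at most `r` in the second
variable, followed by those of order at most `r` in the first variable, exist and are jointly
continuous. -/
structure IsCrrOn (r : ℕ) (S T : Set E) (G : E × E → F) : Prop where
  snd : ∀ u ∈ S, ContDiffOn ℝ r (fun v => G (u, v)) T
  fst : ∀ j ≤ r, ∀ v ∈ T,
    ContDiffOn ℝ r (fun u => iteratedFDerivWithin ℝ j (fun v' => G (u, v')) T v) S
  cont : ∀ i ≤ r, ∀ j ≤ r, ContinuousOn (mixedDeriv i j S T G) (S ×ˢ T)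

theorem mixedDeriv_zero (i j : ℕ) (S T : Set E) :
    mixedDeriv i j S T (fun _ => (0 : F)) = 0 := by
  funext z
  have h : (fun _ : E => iteratedFDerivWithin ℝ j (fun _ : E => (0 : F)) T z.2) =
      fun _ => 0 := by
    funext u
    rw [iteratedFDerivWithin_fun_zero]
    rfl
  simp only [mixedDeriv]
  rw [h, iteratedFDerivWithin_fun_zero]
  rfl

theorem isCrrOn_zero (r : ℕ) (S T : Set E) : IsCrrOn r S T (fun _ : E × E => (0 : F)) where
  snd _ _ := contDiffOn_const
  fst j _ v _ := contDiffOn_const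
  cont i _ j _ := by
    rw [mixedDeriv_zero]
    exact continuousOn_const

end Mixed

section Crr

variable (I : ModelWithCorners ℝ (EuclideanSpace ℝ (Fin m)) H)
  (M : Type*) [TopologicalSpace M] [ChartedSpace H M]

/-- A function on `M × M`, read in a chart `e` for the first variable and a chart `e'` for the
second. -/
def inCharts {M : Type*} [TopologicalSpace M] {F : Type*} (e e' : OpenPartialHomeomorph M H)
    (K : M × M → F) (z : EuclideanSpace ℝ (Fin m) × EuclideanSpace ℝ (Fin m)) : F :=
  K ((e.extend I).symm z.1, (e'.extend I).symm z.2)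

/-- The space `C^{r,r}(M × M, ℝ^{k×k})` of the functions that have continuous partial derivatives
of order at most `r` with respect to both product variables. -/
def CrrMap (k r : ℕ) :=
  {K : M × M → Fin k → Fin k → ℝ //
    ∀ e ∈ IsManifold.maximalAtlas I ∞ M, ∀ e' ∈ IsManifold.maximalAtlas I ∞ M,
      IsCrrOn r (e.extend I).target (e'.extend I).target (inCharts I e e' K)}

instance (k r : ℕ) : CoeFun (CrrMap I M k r) (fun _ => M × M → Fin k → Fin k → ℝ) :=
  ⟨Subtype.val⟩

instance (k r : ℕ) : Zero (CrrMap I M k r) :=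
  ⟨⟨fun _ => 0, fun _ _ _ _ => isCrrOn_zero r _ _⟩⟩

/-- The topology of `C^{r,r}(M × M, ℝ^{k×k})`: uniform convergence of the mixed derivatives of
order at most `r` in each variable, on every compact subset of the image of every product of two
smooth charts. -/
instance (k r : ℕ) : TopologicalSpace (CrrMap I M k r) :=
  ⨅ (e : OpenPartialHomeomorph M H) (_ : e ∈ IsManifold.maximalAtlas I ∞ M)
    (e' : OpenPartialHomeomorph M H) (_ : e' ∈ IsManifold.maximalAtlas I ∞ M)
    (i : ℕ) (_ : i ≤ r) (j : ℕ) (_ : j ≤ r),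
    TopologicalSpace.induced
      (fun K : CrrMap I M k r =>
        UniformOnFun.ofFun {C | IsCompact C ∧ C ⊆ (e.extend I).target ×ˢ (e'.extend I).target}
          (mixedDeriv i j (e.extend I).target (e'.extend I).target (inCharts I e e' K.1)))
      inferInstance

end Crr

section Fields

variable {I : ModelWithCorners ℝ (EuclideanSpace ℝ (Fin m)) H}
  {M : Type*} [TopologicalSpace M] [ChartedSpace H M] {k r : ℕ}
  {Ω : Type*} [MeasurableSpace Ω]

/-- `X` is a (centered) `C^r` Gaussian random field on the probability space `(Ω, P)`: a random
element of `C^r(M, ℝᵏ)` such that `(X(p₁), …, X(p_j))` is a centered, possibly degenerate,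
Gaussian vector for all finite families of points of `M`. -/
structure IsGaussianField (P : Measure Ω) (X : Ω → CrMap I M k r) : Prop where
  measurable : Measurable X
  gaussian : ∀ (j : ℕ) (p : Fin j → M), IsGaussian (P.map (fun w i => X w (p i)))
  centered : ∀ p : M, ∫ w, X w p ∂P = 0

/-- The covariance function `(p, q) ↦ 𝔼[X(p) X(q)ᵀ]`. -/
def covarianceFun (P : Measure Ω) (X : Ω → CrMap I M k r) (z : M × M) : Fin k → Fin k → ℝ :=
  fun a b => ∫ w, X w z.1 a * X w z.2 b ∂P

variable (I M k r) in
/-- The space `𝒢(E^r)` of Gaussian measures on `E^r = C^r(M, ℝᵏ)`, with the topology induced by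
the narrow topology on the Borel probability measures on `E^r`. -/
abbrev GaussianMeasure :=
  {μ : ProbabilityMeasure (CrMap I M k r) // IsGaussianField (μ : Measure (CrMap I M k r)) id}

/-- The covariance function `(p, q) ↦ ∫ f(p) f(q)ᵀ dμ(f)` of a Gaussian measure. -/
def covarianceOf (μ : GaussianMeasure I M k r) : M × M → Fin k → Fin k → ℝ :=
  covarianceFun (μ.1 : Measure (CrMap I M k r)) id

variable (I M k r) in
/-- The image of the covariance map `μ ↦ K_μ` in `C^{r,r}(M × M, ℝ^{k×k})`, with the subspace
topology. -/
abbrev CovarianceImage :=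
  {K : CrrMap I M k r // ∃ μ : GaussianMeasure I M k r, covarianceOf μ = K.1}

end Fields

end GRF

end

/-! The covariance controls a Gaussian field pointwise in variance, whereas convergence in `C^r` is
uniform, and the maximum of many independent Gaussian variables of small variance need not be small.

Inside one chart ball, take smooth functions `f_l` with disjoint supports, uniformly bounded in
`C^r`, each having the same nonzero value `c` of one derivative of order `r` at some point `z_l`.
They come from dilating a single bump by `2^l` and dividing by `2^(l r)`. For independent standard
Gaussian `w_l`, put `X_n = ∑_{l < N_n} w_l f_l v_n`, with vectors `v_n ≠ 0` tending to zero. The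
covariance of `X_n` is `∑ f_l(p) f_l(q) v_n v_nᵀ`. At each point at most one term survives, so its
mixed derivatives are bounded on compact sets by a constant times the size of `v_n v_nᵀ`, whatever
`N_n` is (`tendsto_kernel`). Once `v_n` is fixed, `N_n` can be taken so large that with probability
at least `1/2` some `|w_l|` exceeds `1 / (|c| ‖v_n‖)`; then a derivative of `X_n` of order `r` has
norm at least 1 at some `z_l`. The bounded continuous functional `test`, a supremum of truncated
derivatives at the `z_l`, thus has expectation at least `1/2` under `X_n` and vanishes at the zero
field.

For the inverse covariance map, an arbitrary right inverse must be compared with these explicit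
fields. The covariance determines the finite-dimensional laws, hence the law on the cylinder
σ-algebra (`map_eval_eq`). Derivatives at interior points are limits of difference quotients, so
`test` is cylinder measurable and its expectation depends only on the covariance
(`integral_test_eq`). -/

namespace GRF

/-! ### Rescaled bumps in Euclidean space -/

section Euclidean

variable {E F : Type*} [NormedAddCommGroup E] [NormedSpace ℝ E]
  [NormedAddCommGroup F] [NormedSpace ℝ F]

/-- On a space of positive dimension, no derivative of a nonzero compactly supported function
vanishes identically. -/
theorem exists_iteratedFDeriv_ne_zero [NoncompactSpace E] {ψ : E → F} (hψ : ContDiff ℝ ∞ ψ)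
    (hs : HasCompactSupport ψ) (h0 : ∃ x, ψ x ≠ 0) (r : ℕ) :
    ∃ z, iteratedFDeriv ℝ r ψ z ≠ 0 := by
  induction r with
  | zero =>
    obtain ⟨x, hx⟩ := h0
    refine ⟨x, fun h => hx ?_⟩
    rw [← iteratedFDeriv_zero_apply (𝕜 := ℝ) (f := ψ) (x := x) 0, h]
    rfl
  | succ r ih =>
    by_contra! h
    obtain ⟨z, hz⟩ := ih
    have hd : Differentiable ℝ (iteratedFDeriv ℝ r ψ) :=
      hψ.differentiable_iteratedFDeriv (by exact_mod_cast WithTop.coe_lt_top r)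
    have hc := is_const_of_fderiv_eq_zero hd (fun x => by
      ext m m'
      have := iteratedFDeriv_succ_apply_left (𝕜 := ℝ) (f := ψ) (x := x) (Fin.cons m m')
      rw [h x] at this
      simpa using this.symm)
    -- A constant derivative of order `r` vanishes off the compact support, hence everywhere,
    -- contrary to the induction hypothesis.
    obtain ⟨x, hx⟩ := (Set.ne_univ_iff_exists_notMem _).1 (hs.iteratedFDeriv (𝕜 := ℝ) r).ne_univ
    exact hz ((hc z x).trans (image_eq_zero_of_notMem_tsupport hx))

/-- The dilations `x ↦ 2^{-lr} ψ (2ˡ (x - y₀))`. -/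
noncomputable def dilate (ψ : E → ℝ) (r : ℕ) (y₀ : E) (l : ℕ) (x : E) : ℝ :=
  ((2 : ℝ) ^ (l * r))⁻¹ * ψ ((2 : ℝ) ^ l • (x - y₀))

theorem contDiff_dilate {ψ : E → ℝ} (hψ : ContDiff ℝ ∞ ψ) (r : ℕ) (y₀ : E) (l : ℕ) :
    ContDiff ℝ ∞ (dilate ψ r y₀ l) :=
  contDiff_const.mul (hψ.comp (contDiff_const.smul (contDiff_id.sub contDiff_const)))

theorem iteratedFDeriv_dilate {ψ : E → ℝ} (hψ : ContDiff ℝ ∞ ψ) (r : ℕ) (y₀ : E) (l i : ℕ)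
    (x : E) : iteratedFDeriv ℝ i (dilate ψ r y₀ l) x =
      (((2 : ℝ) ^ (l * r))⁻¹ * 2 ^ (l * i)) • iteratedFDeriv ℝ i ψ ((2 : ℝ) ^ l • (x - y₀)) := by
  have hi : ContDiff ℝ i ψ := hψ.of_le (by exact_mod_cast le_top)
  have h2 : ContDiff ℝ i (fun z => ψ ((2 : ℝ) ^ l • z)) :=
    hi.comp (contDiff_const.smul contDiff_id)
  have h1 : dilate ψ r y₀ l = ((2 : ℝ) ^ (l * r))⁻¹ • fun x => ψ ((2 : ℝ) ^ l • (x - y₀)) := rfl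
  have h3 : ContDiff ℝ i (fun x => ψ ((2 : ℝ) ^ l • (x - y₀))) :=
    h2.comp (contDiff_id.sub contDiff_const)
  have h4 : iteratedFDeriv ℝ i (fun x => ψ ((2 : ℝ) ^ l • (x - y₀))) x =
      iteratedFDeriv ℝ i (fun z => ψ ((2 : ℝ) ^ l • z)) (x - y₀) :=
    iteratedFDeriv_comp_sub (f := fun z => ψ ((2 : ℝ) ^ l • z)) i y₀ x
  rw [h1, iteratedFDeriv_const_smul_apply h3.contDiffAt, h4,
    iteratedFDeriv_comp_const_smul _ hi, ← pow_mul, mul_smul]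

/-- Each derivative gains a factor `2^l`, and the normalisation `2^(-l r)` absorbs up to `r` of
them. At order exactly `r` the factors cancel, so that derivative keeps its size. -/
theorem norm_iteratedFDeriv_dilate_le {ψ : E → ℝ} (hψ : ContDiff ℝ ∞ ψ) {r i : ℕ} (hi : i ≤ r)
    (y₀ : E) (l : ℕ) {B : ℝ} (hB : ∀ x, ‖iteratedFDeriv ℝ i ψ x‖ ≤ B) (x : E) :
    ‖iteratedFDeriv ℝ i (dilate ψ r y₀ l) x‖ ≤ B := by
  rw [iteratedFDeriv_dilate hψ, norm_smul]
  have h0 : (0 : ℝ) < 2 ^ (l * r) := by positivity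
  have h1 : ‖((2 : ℝ) ^ (l * r))⁻¹ * 2 ^ (l * i)‖ ≤ 1 := by
    rw [Real.norm_of_nonneg (by positivity), inv_mul_le_iff₀ h0, mul_one]
    exact pow_le_pow_right₀ one_le_two (Nat.mul_le_mul_left l hi)
  calc _ ≤ 1 * B := mul_le_mul h1 (hB _) (norm_nonneg _) zero_le_one
    _ = B := one_mul B

theorem tsupport_dilate_subset {ψ : E → ℝ} (r : ℕ) (y₀ : E) (l : ℕ) :
    tsupport (dilate ψ r y₀ l) ⊆ {x | (2 : ℝ) ^ l • (x - y₀) ∈ tsupport ψ} := by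
  refine closure_minimal (fun x hx => subset_tsupport _ fun h => hx ?_)
    ((isClosed_tsupport ψ).preimage (by fun_prop))
  simp [dilate, h]

/-- A sequence of smooth functions with disjoint supports in a ball, bounded in `C^r`, whose
derivatives of order `r` do not become small. -/
theorem exists_bounded_disjoint_sequence [FiniteDimensional ℝ E] [Nontrivial E] (y₀ : E) {R : ℝ}
    (hR : 0 < R) (r : ℕ) :
    ∃ (g : ℕ → E → ℝ) (z : ℕ → E) (V : Fin r → E) (c B : ℝ), c ≠ 0 ∧
      (∀ l, ContDiff ℝ ∞ (g l)) ∧ (∀ l, tsupport (g l) ⊆ Metric.closedBall y₀ R) ∧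
      (∀ l l', l ≠ l' → Disjoint (tsupport (g l)) (tsupport (g l'))) ∧
      (∀ l, z l ∈ tsupport (g l)) ∧ (∀ l, iteratedFDeriv ℝ r (g l) (z l) V = c) ∧
      ∀ i ≤ r, ∀ l x, ‖iteratedFDeriv ℝ i (g l) x‖ ≤ B := by
  -- A bump of radius `R/8` about a point of norm `3R/4` lives in the annulus `R/2 < ‖x‖ < R`.
  -- Dilations by distinct powers of 2 carry this annulus to disjoint ones.
  obtain ⟨v, hv⟩ := exists_norm_eq E (show 0 ≤ 3 / 4 * R by positivity)
  let ψ : ContDiffBump v := ⟨R / 16, R / 8, by positivity, by linarith⟩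
  have hψ : ContDiff ℝ ∞ ψ := ψ.contDiff
  have hs : HasCompactSupport ψ := ψ.hasCompactSupport
  have : NoncompactSpace E := NormedSpace.noncompactSpace ℝ E
  obtain ⟨z, hz⟩ := exists_iteratedFDeriv_ne_zero hψ hs
    ⟨v, by rw [ψ.one_of_mem_closedBall (Metric.mem_closedBall_self ψ.rIn_pos.le)]; simp⟩ r
  obtain ⟨V, hV⟩ : ∃ V, iteratedFDeriv ℝ r ψ z V ≠ 0 := by
    by_contra! h
    exact hz (ContinuousMultilinearMap.ext h)
  have hB : ∀ i, ∃ B, ∀ x, ‖iteratedFDeriv ℝ i ψ x‖ ≤ B := fun i =>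
    (hψ.continuous_iteratedFDeriv (by exact_mod_cast le_top)).bounded_above_of_compact_support
      (hs.iteratedFDeriv i)
  choose B hB using hB
  have hnorm : ∀ l, ∀ x ∈ tsupport (dilate ψ r y₀ l),
      R / 2 < 2 ^ l * ‖x - y₀‖ ∧ 2 ^ l * ‖x - y₀‖ < R := by
    intro l x hx
    have h1 := tsupport_dilate_subset r y₀ l hx
    simp only [Set.mem_ofPred_eq, ψ.tsupport_eq, Metric.mem_closedBall, dist_eq_norm] at h1
    have h2 : ‖(2 : ℝ) ^ l • (x - y₀)‖ = 2 ^ l * ‖x - y₀‖ := by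
      rw [norm_smul, Real.norm_of_nonneg (by positivity)]
    have h3 := abs_le.1 ((abs_norm_sub_norm_le _ _).trans h1)
    rw [h2, hv] at h3
    have h4 : ψ.rOut = R / 8 := rfl
    constructor <;> linarith [h3.1, h3.2]
  have hlt : ∀ l l', l < l' →
      Disjoint (tsupport (dilate ψ r y₀ l)) (tsupport (dilate ψ r y₀ l')) := by
    intro l l' hl
    refine Set.disjoint_left.2 fun x hx hx' => ?_
    have h1 := (hnorm l x hx).1
    have h2 := (hnorm l' x hx').2
    have h3 : (2 : ℝ) ^ (l + 1) ≤ 2 ^ l' := pow_le_pow_right₀ one_le_two hl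
    have h4 := mul_le_mul_of_nonneg_right h3 (norm_nonneg (x - y₀))
    rw [pow_succ] at h4
    linarith
  have hpt : ∀ l : ℕ, (2 : ℝ) ^ l • (y₀ + ((2 : ℝ) ^ l)⁻¹ • z - y₀) = z := fun l => by
    rw [add_sub_cancel_left, smul_inv_smul₀ (by positivity)]
  have hval : ∀ l, iteratedFDeriv ℝ r (dilate ψ r y₀ l) (y₀ + ((2 : ℝ) ^ l)⁻¹ • z) =
      iteratedFDeriv ℝ r ψ z := fun l => by
    rw [iteratedFDeriv_dilate hψ, hpt, inv_mul_cancel₀ (by positivity), one_smul]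
  -- The sum of the bounds for the orders `0, …, r` serves all these orders at once.
  refine ⟨dilate ψ r y₀, fun l => y₀ + ((2 : ℝ) ^ l)⁻¹ • z, V, iteratedFDeriv ℝ r ψ z V,
    ∑ i ∈ Finset.range (r + 1), B i, hV, contDiff_dilate hψ r y₀, fun l x hx => ?_, ?_,
    fun l => ?_, fun l => by rw [hval], fun i hi l x => ?_⟩
  · rw [Metric.mem_closedBall, dist_eq_norm]
    have h1 := (hnorm l x hx).2
    have h3 : (1 : ℝ) ≤ 2 ^ l := one_le_pow₀ one_le_two
    nlinarith [norm_nonneg (x - y₀)]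
  · intro l l' hl
    rcases lt_or_gt_of_ne hl with h | h
    · exact hlt l l' h
    · exact (hlt l' l h).symm
  · exact support_iteratedFDeriv_subset (𝕜 := ℝ) r (by
      rw [Function.mem_support, hval]
      exact hz)
  · refine (norm_iteratedFDeriv_dilate_le hψ hi y₀ l (hB i) x).trans ?_
    exact Finset.single_le_sum (f := B) (fun j _ => (norm_nonneg _).trans (hB j 0))
      (Finset.mem_range.2 (Nat.lt_succ_of_le hi))

end Euclidean

/-! ### Functions supported in a chart, extended by zero -/

section Charts

variable {m : ℕ} {H : Type*} [TopologicalSpace H]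
  {I : ModelWithCorners ℝ (EuclideanSpace ℝ (Fin m)) H}
  {M : Type*} [TopologicalSpace M] {V : Type*} [NormedAddCommGroup V] [NormedSpace ℝ V]

theorem uniqueDiffOn_extend_target (e : OpenPartialHomeomorph M H) :
    UniqueDiffOn ℝ (e.extend I).target := by
  rw [e.extend_target]
  exact I.uniqueDiffOn_preimage e.open_target

theorem iteratedFDerivWithin_eq_zero_of_notMem (e : OpenPartialHomeomorph M H) {f : M → V}
    {Q : Set M} (hQ : IsClosed Q) (hf : ∀ p ∉ Q, f p = 0) {x : EuclideanSpace ℝ (Fin m)}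
    (hx : x ∈ (e.extend I).target) (hxQ : (e.extend I).symm x ∉ Q) (i : ℕ) :
    iteratedFDerivWithin ℝ i (f ∘ (e.extend I).symm) (e.extend I).target x = 0 := by
  have h : f ∘ (e.extend I).symm =ᶠ[𝓝[(e.extend I).target] x] fun _ => 0 := by
    filter_upwards [(e.continuousOn_extend_symm (I := I) x hx).preimage_mem_nhdsWithin
      (hQ.isOpen_compl.mem_nhds hxQ)] with y hy using hf _ hy
  rw [h.iteratedFDerivWithin_eq (h.eq_of_nhdsWithin hx), iteratedFDerivWithin_fun_zero]
  rfl

variable (I) in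
/-- The extension by zero to `M` of a function read in a chart. -/
noncomputable def extendByZero (e : OpenPartialHomeomorph M H)
    (g : EuclideanSpace ℝ (Fin m) → ℝ) : M → ℝ :=
  e.source.indicator (g ∘ e.extend I)

theorem extendByZero_eq_zero {e : OpenPartialHomeomorph M H}
    {g : EuclideanSpace ℝ (Fin m) → ℝ} {Z : Set (EuclideanSpace ℝ (Fin m))}
    (hg : tsupport g ⊆ Z) (p : M) (hp : p ∉ (e.extend I).symm '' Z) :
    extendByZero I e g p = 0 := by
  by_cases hs : p ∈ e.source
  · rw [extendByZero, Set.indicator_of_mem hs]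
    by_contra h
    exact hp ⟨_, hg (subset_tsupport _ h), e.extend_left_inv hs⟩
  · rw [extendByZero, Set.indicator_of_notMem hs]

theorem extendByZero_comp_eqOn (e : OpenPartialHomeomorph M H)
    (g : EuclideanSpace ℝ (Fin m) → ℝ) :
    Set.EqOn (extendByZero I e g ∘ (e.extend I).symm) g (e.extend I).target := by
  intro y hy
  have h : (e.extend I).symm y ∈ e.source := by
    simpa using (e.extend I).map_target hy
  rw [Function.comp_apply, extendByZero, Set.indicator_of_mem h, Function.comp_apply,
    (e.extend I).right_inv hy]

theorem isCompact_extend_symm_image (e : OpenPartialHomeomorph M H)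
    {Z : Set (EuclideanSpace ℝ (Fin m))} (hZ : IsCompact Z) (hZt : Z ⊆ (e.extend I).target) :
    IsCompact ((e.extend I).symm '' Z) :=
  hZ.image_of_continuousOn (e.continuousOn_extend_symm.mono hZt)

variable [ChartedSpace H M]

theorem contDiffOn_comp_extend_symm {e : OpenPartialHomeomorph M H}
    (he : e ∈ IsManifold.maximalAtlas I ∞ M) {n : WithTop ℕ∞} (hn : n ≤ ∞) {f : M → V}
    (hf : ContMDiff I 𝓘(ℝ, V) n f) :
    ContDiffOn ℝ n (f ∘ (e.extend I).symm) (e.extend I).target := by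
  rw [← contMDiffOn_iff_contDiffOn, e.extend_target']
  exact hf.comp_contMDiffOn ((contMDiffOn_extend_symm he).of_le hn)

variable [T2Space M]

/-- Smoothness is checked on the chart domain and on the complement of the support. The latter is
open because the image of `Z` is compact, hence closed in the Hausdorff space `M`. -/
theorem contMDiff_extendByZero {e : OpenPartialHomeomorph M H}
    (he : e ∈ IsManifold.maximalAtlas I ∞ M) {g : EuclideanSpace ℝ (Fin m) → ℝ}
    (hg : ContDiff ℝ ∞ g) {Z : Set (EuclideanSpace ℝ (Fin m))} (hZ : IsCompact Z)
    (hZt : Z ⊆ (e.extend I).target) (hgZ : tsupport g ⊆ Z) :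
    ContMDiff I 𝓘(ℝ) ∞ (extendByZero I e g) := by
  intro p
  by_cases hs : p ∈ e.source
  · have h1 : ContMDiffAt I 𝓘(ℝ, EuclideanSpace ℝ (Fin m)) ∞ (e.extend I) p :=
      I.contMDiff.contMDiffAt.comp p (contMDiffAt_of_mem_maximalAtlas he hs)
    refine (hg.contMDiff.contMDiffAt.comp p h1).congr_of_eventuallyEq ?_
    filter_upwards [e.open_source.mem_nhds hs] with q hq
    rw [extendByZero, Set.indicator_of_mem hq]
  · have hp : p ∉ (e.extend I).symm '' Z := by
      rintro ⟨y, hy, rfl⟩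
      exact hs (by simpa using (e.extend I).map_target (hZt hy))
    refine (contMDiffAt_const (c := (0 : ℝ))).congr_of_eventuallyEq ?_
    filter_upwards [(isCompact_extend_symm_image e hZ hZt).isClosed.isOpen_compl.mem_nhds hp]
      with q hq using extendByZero_eq_zero hgZ q hq

/-- A `C^r` bound in one chart, for functions with support in a given compact set, yields a bound
on every compact subset of every other chart. -/
theorem exists_bound_in_chart {e e' : OpenPartialHomeomorph M H}
    (he : e ∈ IsManifold.maximalAtlas I ∞ M) (he' : e' ∈ IsManifold.maximalAtlas I ∞ M)
    {Z C : Set (EuclideanSpace ℝ (Fin m))} (hZ : IsCompact Z) (hZt : Z ⊆ (e.extend I).target)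
    (hC : IsCompact C) (hCt : C ⊆ (e'.extend I).target) (r : ℕ) :
    ∃ A : ℝ, ∀ (g : EuclideanSpace ℝ (Fin m) → ℝ) (B : ℝ), ContDiff ℝ ∞ g → tsupport g ⊆ Z →
      (∀ i ≤ r, ∀ x, ‖iteratedFDeriv ℝ i g x‖ ≤ B) → ∀ i ≤ r, ∀ x ∈ C,
        ‖iteratedFDerivWithin ℝ i (extendByZero I e g ∘ (e'.extend I).symm)
          (e'.extend I).target x‖ ≤ A * B := by
  set Q := (e.extend I).symm '' Z
  have hQ : IsClosed Q := (isCompact_extend_symm_image e hZ hZt).isClosed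
  have hQs : Q ⊆ e.source := by
    rintro _ ⟨y, hy, rfl⟩
    simpa using (e.extend I).map_target (hZt hy)
  -- Only on this compact set can the extended function be nonzero. It lies in the domain of the
  -- coordinate change, whose derivatives are therefore bounded on it.
  set C' := C ∩ (e'.extend I).symm ⁻¹' Q
  have hC' : IsCompact C' := hC.of_isClosed_subset
    ((e'.continuousOn_extend_symm.mono hCt).preimage_isClosed_of_isClosed hC.isClosed hQ)
    Set.inter_subset_left
  set W := (I.extendCoordChange e' e).source
  have hWeq : W = (e'.extend I).target ∩ (e'.extend I).symm ⁻¹' e.source := by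
    simp only [W, PartialEquiv.trans_source,
      PartialEquiv.symm_source, e.extend_source]
  have hC'W : C' ⊆ W := by
    rw [hWeq]
    exact fun x hx => ⟨hCt hx.1, hQs hx.2⟩
  have hWu : UniqueDiffOn ℝ W := I.uniqueDiffOn_extendCoordChange_source
  have hφ : ContDiffOn ℝ ∞ (I.extendCoordChange e' e) W := I.contDiffOn_extendCoordChange he' he
  have hD : ∀ i : ℕ, ∃ D, ∀ x ∈ C',
      ‖iteratedFDerivWithin ℝ i (I.extendCoordChange e' e) W x‖ ≤ D := fun i =>
    hC'.exists_bound_of_continuousOn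
      ((hφ.continuousOn_iteratedFDerivWithin (by exact_mod_cast le_top) hWu).mono hC'W)
  choose D hD using hD
  -- The chain rule estimate wants the derivative of order `j` bounded by `D' ^ j`; with `D' ≥ 1` a
  -- bound by `D'` suffices for `j ≥ 1`.
  set D' := 1 + ∑ i ∈ Finset.range (r + 1), |D i|
  have hD'1 : 1 ≤ D' := le_add_of_nonneg_right (Finset.sum_nonneg fun _ _ => abs_nonneg _)
  refine ⟨r.factorial * D' ^ r, fun g B hg hgZ hB i hi x hx => ?_⟩
  have hB0 : 0 ≤ B := (norm_nonneg _).trans (hB 0 (Nat.zero_le r) 0)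
  by_cases hxQ : (e'.extend I).symm x ∈ Q
  · have hxC : x ∈ C' := ⟨hx, hxQ⟩
    have hxW := hC'W hxC
    have h1 : iteratedFDerivWithin ℝ i (extendByZero I e g ∘ (e'.extend I).symm)
        (e'.extend I).target x = iteratedFDerivWithin ℝ i (g ∘ I.extendCoordChange e' e) W x := by
      have hu : (e'.extend I).symm ⁻¹' e.source ∈ 𝓝[(e'.extend I).target] x :=
        (e'.continuousOn_extend_symm (I := I) x (hCt hx)).preimage_mem_nhdsWithin
          (e.open_source.mem_nhds (hQs hxQ))
      rw [← iteratedFDerivWithin_inter' hu, ← hWeq]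
      refine iteratedFDerivWithin_congr (fun y hy => ?_) hxW i
      rw [hWeq] at hy
      exact Set.indicator_of_mem (show (e'.extend I).symm y ∈ e.source from hy.2) _
    rw [h1]
    have h2 := norm_iteratedFDerivWithin_comp_le (n := i) (t := Set.univ) (x := x) (C := B)
      (D := D') hg.contDiffOn hφ (by exact_mod_cast le_top) uniqueDiffOn_univ hWu
      (Set.mapsTo_univ _ _) hxW (fun j hj => by
        rw [iteratedFDerivWithin_univ]
        exact hB j (hj.trans hi) _) (fun j hj hji => by
        refine (hD j x hxC).trans (le_trans ?_ (le_self_pow₀ hD'1 (by omega)))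
        refine (le_abs_self _).trans (le_trans ?_ (le_add_of_nonneg_left zero_le_one))
        exact Finset.single_le_sum (f := fun i => |D i|) (fun _ _ => abs_nonneg _)
          (Finset.mem_range.2 (by omega)))
    refine h2.trans ?_
    rw [mul_right_comm]
    gcongr
  · rw [iteratedFDerivWithin_eq_zero_of_notMem e' hQ
      (fun p hp => extendByZero_eq_zero hgZ p hp) (hCt hx) hxQ, norm_zero]
    positivity

end Charts

/-! ### The bump sequence on the manifold -/

section Sequence

variable {m : ℕ} {H : Type*} [TopologicalSpace H]
  (I : ModelWithCorners ℝ (EuclideanSpace ℝ (Fin m)) H)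
  (M : Type*) [TopologicalSpace M] [ChartedSpace H M]

/-- A sequence of functions on `M`, bounded in `C^r` and with disjoint supports, together with
points `z l` of a compact set in a chart, at which a derivative of order `r` separates the
functions. -/
structure BumpSequence (r : ℕ) where
  toFun : ℕ → M → ℝ
  contMDiff : ∀ l, ContMDiff I 𝓘(ℝ) ∞ (toFun l)
  chart : OpenPartialHomeomorph M H
  chart_mem : chart ∈ IsManifold.maximalAtlas I ∞ M
  set : Set (EuclideanSpace ℝ (Fin m))
  isCompact_set : IsCompact set
  set_subset : set ⊆ interior (chart.extend I).target
  point : ℕ → EuclideanSpace ℝ (Fin m)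
  point_mem : ∀ l, point l ∈ set
  vec : Fin r → EuclideanSpace ℝ (Fin m)
  const : ℝ
  const_ne_zero : const ≠ 0
  deriv_self : ∀ l, iteratedFDerivWithin ℝ r (toFun l ∘ (chart.extend I).symm)
    (chart.extend I).target (point l) vec = const
  deriv_other : ∀ l l', l ≠ l' → iteratedFDerivWithin ℝ r (toFun l ∘ (chart.extend I).symm)
    (chart.extend I).target (point l') = 0
  bound : ∀ e ∈ IsManifold.maximalAtlas I ∞ M, ∀ C, IsCompact C → C ⊆ (e.extend I).target →
    ∃ B, ∀ i ≤ r, ∀ l, ∀ x ∈ C,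
      ‖iteratedFDerivWithin ℝ i (toFun l ∘ (e.extend I).symm) (e.extend I).target x‖ ≤ B
  disjoint : ∀ e ∈ IsManifold.maximalAtlas I ∞ M, ∀ x ∈ (e.extend I).target, ∃ l₀, ∀ l ≠ l₀, ∀ i,
    iteratedFDerivWithin ℝ i (toFun l ∘ (e.extend I).symm) (e.extend I).target x = 0

theorem exists_bumpSequence [IsManifold I ∞ M] [T2Space M] [Nonempty M] (hm : 0 < m) (r : ℕ) :
    Nonempty (BumpSequence I M r) := by
  have : Nonempty (Fin m) := ⟨⟨0, hm⟩⟩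
  obtain ⟨p⟩ := ‹Nonempty M›
  set e := chartAt H p
  have he : e ∈ IsManifold.maximalAtlas I ∞ M := IsManifold.chart_mem_maximalAtlas p
  -- The point `p` may lie on the boundary. The range of `I` is in the closure of its interior, so
  -- the chart image still contains an interior point.
  obtain ⟨y₀, hy₀⟩ : (interior (e.extend I).target).Nonempty := by
    have h1 : I (e p) ∈ closure (interior (Set.range I)) :=
      I.range_subset_closure_interior ⟨_, rfl⟩
    have h2 : IsOpen (I.symm ⁻¹' e.target) := e.open_target.preimage I.continuous_symm
    obtain ⟨y, hy⟩ := mem_closure_iff.1 h1 _ h2 (by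
      rw [Set.mem_preimage, I.left_inv]
      exact e.map_source (mem_chart_source H p))
    refine ⟨y, mem_interior.2 ⟨_, ?_, h2.inter isOpen_interior, hy⟩⟩
    rw [e.extend_target]
    exact Set.inter_subset_inter_right _ interior_subset
  obtain ⟨R, hR, hball⟩ := Metric.nhds_basis_closedBall.mem_iff.1 (isOpen_interior.mem_nhds hy₀)
  obtain ⟨g, z, V, c, B, hc, hg, hgs, hgd, hz, hzc, hB⟩ :=
    exists_bounded_disjoint_sequence y₀ hR r
  set Z := Metric.closedBall y₀ R
  have hZ : IsCompact Z := isCompact_closedBall y₀ R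
  have hZt : Z ⊆ (e.extend I).target := hball.trans interior_subset
  have hderiv : ∀ l, ∀ y ∈ Z, ∀ i, iteratedFDerivWithin ℝ i
      (extendByZero I e (g l) ∘ (e.extend I).symm) (e.extend I).target y =
        iteratedFDeriv ℝ i (g l) y := by
    intro l y hy i
    rw [iteratedFDerivWithin_congr (extendByZero_comp_eqOn e (g l)) (hZt hy) i,
      ← iteratedFDerivWithin_univ]
    exact iteratedFDerivWithin_congr_set
      (eventuallyEq_univ.2 (mem_interior_iff_mem_nhds.1 (hball hy))) i
  exact ⟨{
    toFun := fun l => extendByZero I e (g l)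
    contMDiff := fun l => contMDiff_extendByZero he (hg l) hZ hZt (hgs l)
    chart := e
    chart_mem := he
    set := Z
    isCompact_set := hZ
    set_subset := hball
    point := z
    point_mem := fun l => hgs l (hz l)
    vec := V
    const := c
    const_ne_zero := hc
    deriv_self := fun l => by rw [hderiv l _ (hgs l (hz l)), hzc]
    deriv_other := fun l l' hl => by
      rw [hderiv l _ (hgs l' (hz l'))]
      by_contra h
      exact (Set.disjoint_right.1 (hgd l l' hl) (hz l'))
        (support_iteratedFDeriv_subset (𝕜 := ℝ) r h)
    bound := fun e' he' C hC hCt => by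
      obtain ⟨A, hA⟩ := exists_bound_in_chart he he' hZ hZt hC hCt r
      exact ⟨A * B, fun i hi l x hx =>
        hA (g l) B (hg l) (hgs l) (fun j hj y => hB j hj l y) i hi x hx⟩
    disjoint := fun e' he' x hx => by
      have hQ : ∀ l, IsClosed ((e.extend I).symm '' tsupport (g l)) := fun l =>
        (isCompact_extend_symm_image e (hZ.of_isClosed_subset (isClosed_tsupport _) (hgs l))
          ((hgs l).trans hZt)).isClosed
      have hvan : ∀ l, (e'.extend I).symm x ∉ (e.extend I).symm '' tsupport (g l) → ∀ i,
          iteratedFDerivWithin ℝ i (extendByZero I e (g l) ∘ (e'.extend I).symm)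
            (e'.extend I).target x = 0 := fun l hl i =>
        iteratedFDerivWithin_eq_zero_of_notMem e' (hQ l)
          (fun p hp => extendByZero_eq_zero subset_rfl p hp) hx hl i
      by_cases h : ∃ l₀, (e'.extend I).symm x ∈ (e.extend I).symm '' tsupport (g l₀)
      · obtain ⟨l₀, y, hy, hyx⟩ := h
        refine ⟨l₀, fun l hl => hvan l ?_⟩
        rintro ⟨y', hy', hyx'⟩
        have : y' = y := (e.extend I).symm.injOn (hZt (hgs l hy')) (hZt (hgs l₀ hy))
          (hyx'.trans hyx.symm)
        exact Set.disjoint_left.1 (hgd l l₀ hl) hy' (this ▸ hy)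
      · exact ⟨0, fun l _ => hvan l fun hl => h ⟨l, hl⟩⟩ }⟩

end Sequence

/-! ### Derivatives of finite sums of product kernels -/

section Sums

variable {W : Type*} [NormedAddCommGroup W]

theorem norm_sum_le_of_eq_zero {x : ℕ → W} {B : ℝ} (hB : ∀ l, ‖x l‖ ≤ B) {l₀ : ℕ}
    (hx : ∀ l ≠ l₀, x l = 0) (N : ℕ) : ‖∑ l ∈ Finset.range N, x l‖ ≤ B := by
  by_cases hmem : l₀ ∈ Finset.range N
  · rw [Finset.sum_eq_single_of_mem l₀ hmem fun l _ => hx l]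
    exact hB l₀
  · rw [Finset.sum_eq_zero fun l hl => hx l fun h => hmem (h ▸ hl), norm_zero]
    exact (norm_nonneg _).trans (hB 0)

theorem tendstoUniformlyOn_zero_of_norm_le {α : Type*} {G : ℕ → α → W} {C : Set α} {a : ℕ → ℝ}
    (ha : Tendsto a atTop (𝓝 0)) (hG : ∀ n, ∀ z ∈ C, ‖G n z‖ ≤ a n) :
    TendstoUniformlyOn G 0 atTop C := by
  rw [Metric.tendstoUniformlyOn_iff]
  intro ε hε
  filter_upwards [ha.eventually_lt_const hε] with n hn z hz
  rw [Pi.zero_apply, dist_zero_left]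
  exact (hG n z hz).trans_lt hn

variable {E : Type*} [NormedAddCommGroup E] [NormedSpace ℝ E] [NormedSpace ℝ W]

theorem iteratedFDerivWithin_sum_smul {g : ℕ → E → ℝ} {S : Set E} (hS : UniqueDiffOn ℝ S) {i : ℕ}
    (hg : ∀ l, ContDiffOn ℝ i (g l) S) {x : E} (hx : x ∈ S) (Y : ℕ → W) (N : ℕ) :
    iteratedFDerivWithin ℝ i (fun u => ∑ l ∈ Finset.range N, g l u • Y l) S x =
      ∑ l ∈ Finset.range N, (iteratedFDerivWithin ℝ i (g l) S x).smulRight (Y l) := by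
  rw [iteratedFDerivWithin_fun_sum_apply (f := fun l u => g l u • Y l) hS hx
    fun l _ => (hg l x hx).smul_const (Y l)]
  refine Finset.sum_congr rfl fun l _ => ?_
  rw [iteratedFDerivWithin_smul_const_apply (hg l x hx) hS hx]
  ext v
  simp

variable {g h : ℕ → E → ℝ} {S T : Set E} {r : ℕ}

theorem mixedDeriv_sum_smul (hS : UniqueDiffOn ℝ S) (hT : UniqueDiffOn ℝ T) {i j : ℕ}
    (hg : ∀ l, ContDiffOn ℝ i (g l) S) (hh : ∀ l, ContDiffOn ℝ j (h l) T) (A : W) (N : ℕ)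
    {z : E × E} (hz : z ∈ S ×ˢ T) :
    mixedDeriv i j S T (fun z => ∑ l ∈ Finset.range N, g l z.1 • h l z.2 • A) z =
      ∑ l ∈ Finset.range N, (iteratedFDerivWithin ℝ i (g l) S z.1).smulRight
        ((iteratedFDerivWithin ℝ j (h l) T z.2).smulRight A) := by
  rw [mixedDeriv, ← iteratedFDerivWithin_sum_smul hS hg hz.1]
  congr 1
  funext u
  simp only [smul_comm (g _ u)]
  rw [iteratedFDerivWithin_sum_smul hT hh hz.2]
  refine Finset.sum_congr rfl fun l _ => ?_
  ext v
  simp [smul_comm (g l u)]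

theorem isCrrOn_sum_smul (hS : UniqueDiffOn ℝ S) (hT : UniqueDiffOn ℝ T)
    (hg : ∀ l, ContDiffOn ℝ r (g l) S) (hh : ∀ l, ContDiffOn ℝ r (h l) T) (A : W) (N : ℕ) :
    IsCrrOn r S T (fun z => ∑ l ∈ Finset.range N, g l z.1 • h l z.2 • A) where
  snd u _ := ContDiffOn.sum fun l _ => ((hh l).smul_const A).const_smul (g l u)
  fst j hj v hv := by
    have hj' : (j : WithTop ℕ∞) ≤ r := by exact_mod_cast hj
    have : (fun u => iteratedFDerivWithin ℝ j
        (fun v' => ∑ l ∈ Finset.range N, g l u • h l v' • A) T v) = fun u =>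
          ∑ l ∈ Finset.range N, g l u • (iteratedFDerivWithin ℝ j (h l) T v).smulRight A := by
      funext u
      simp only [smul_comm (g _ u)]
      rw [iteratedFDerivWithin_sum_smul hT (fun l => (hh l).of_le hj') hv]
      refine Finset.sum_congr rfl fun l _ => ?_
      ext v
      simp [smul_comm (g l u)]
    rw [this]
    exact ContDiffOn.sum fun l _ => (hg l).smul_const _
  cont i hi j hj := by
    have hi' : (i : WithTop ℕ∞) ≤ r := by exact_mod_cast hi
    have hj' : (j : WithTop ℕ∞) ≤ r := by exact_mod_cast hj
    refine ContinuousOn.congr ?_ fun z hz => mixedDeriv_sum_smul hS hT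
      (fun l => (hg l).of_le hi') (fun l => (hh l).of_le hj') A N hz
    refine continuousOn_finsetSum _ fun l _ => ?_
    have h1 : ContinuousOn (fun z : E × E => iteratedFDerivWithin ℝ i (g l) S z.1) (S ×ˢ T) :=
      ((hg l).continuousOn_iteratedFDerivWithin hi' hS).comp continuousOn_fst fun z hz => hz.1
    have h2 : ContinuousOn (fun z : E × E => iteratedFDerivWithin ℝ j (h l) T z.2) (S ×ˢ T) :=
      ((hh l).continuousOn_iteratedFDerivWithin hj' hT).comp continuousOn_snd fun z hz => hz.2
    have h3 : ContinuousOn (fun z : E × E =>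
        (iteratedFDerivWithin ℝ j (h l) T z.2).smulRight A) (S ×ˢ T) :=
      ((ContinuousMultilinearMap.smulRightL ℝ (fun _ : Fin j => E) W).flip A).continuous
        |>.comp_continuousOn h2
    exact ((ContinuousMultilinearMap.smulRightL ℝ (fun _ : Fin i => E)
      (E [×j]→L[ℝ] W)).continuous.comp_continuousOn h1).clm_apply h3

/-- The bound does not depend on `N`, since at most one term is nonzero. Disjointness in the first
variable alone is enough. -/
theorem norm_mixedDeriv_sum_smul_le (hS : UniqueDiffOn ℝ S) (hT : UniqueDiffOn ℝ T) {i j : ℕ}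
    (hg : ∀ l, ContDiffOn ℝ i (g l) S) (hh : ∀ l, ContDiffOn ℝ j (h l) T) (A : W) (N : ℕ)
    {z : E × E} (hz : z ∈ S ×ˢ T) {B B' : ℝ}
    (hB : ∀ l, ‖iteratedFDerivWithin ℝ i (g l) S z.1‖ ≤ B)
    (hB' : ∀ l, ‖iteratedFDerivWithin ℝ j (h l) T z.2‖ ≤ B') {l₀ : ℕ}
    (hl₀ : ∀ l ≠ l₀, iteratedFDerivWithin ℝ i (g l) S z.1 = 0) :
    ‖mixedDeriv i j S T (fun z => ∑ l ∈ Finset.range N, g l z.1 • h l z.2 • A) z‖ ≤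
      B * (B' * ‖A‖) := by
  rw [mixedDeriv_sum_smul hS hT hg hh A N hz]
  have hb : ∀ l, ‖(iteratedFDerivWithin ℝ i (g l) S z.1).smulRight
      ((iteratedFDerivWithin ℝ j (h l) T z.2).smulRight A)‖ ≤ B * (B' * ‖A‖) := fun l => by
    rw [ContinuousMultilinearMap.norm_smulRight, ContinuousMultilinearMap.norm_smulRight]
    have := hB' l
    have := (norm_nonneg _).trans (hB l)
    gcongr
    exact hB l
  exact norm_sum_le_of_eq_zero (W := E [×i]→L[ℝ] E [×j]→L[ℝ] W)
    (x := fun l => (iteratedFDerivWithin ℝ i (g l) S z.1).smulRight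
      ((iteratedFDerivWithin ℝ j (h l) T z.2).smulRight A)) hb
    (fun l hl => by rw [hl₀ l hl]; ext; simp) N

end Sums

/-! ### Convergence in `C^r` and in `C^{r,r}` -/

section Topology

variable {m : ℕ} {H : Type*} [TopologicalSpace H]
  {I : ModelWithCorners ℝ (EuclideanSpace ℝ (Fin m)) H}
  {M : Type*} [TopologicalSpace M] [ChartedSpace H M] {k r : ℕ}

theorem tendsto_crMap_iff {α : Type*} {u : Filter α} {f : α → CrMap I M k r} {f₀ : CrMap I M k r} :
    Tendsto f u (𝓝 f₀) ↔ ∀ e ∈ IsManifold.maximalAtlas I ∞ M, ∀ i ≤ r, ∀ C, IsCompact C →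
      C ⊆ (e.extend I).target → TendstoUniformlyOn
        (fun a => iteratedFDerivWithin ℝ i (f a ∘ (e.extend I).symm) (e.extend I).target)
        (iteratedFDerivWithin ℝ i (f₀ ∘ (e.extend I).symm) (e.extend I).target) u C := by
  simp only [nhds_iInf, tendsto_iInf, nhds_induced, tendsto_comap_iff]
  refine forall₄_congr fun e _ i _ => ?_
  rw [UniformOnFun.tendsto_iff_tendstoUniformlyOn]
  exact ⟨fun h C hC hCt => h C ⟨hC, hCt⟩, fun h C hC => h C hC.1 hC.2⟩

theorem tendsto_crrMap_zero_of_bound {K : ℕ → CrrMap I M k r} {a : ℕ → ℝ}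
    (ha : Tendsto a atTop (𝓝 0))
    (h : ∀ e ∈ IsManifold.maximalAtlas I ∞ M, ∀ e' ∈ IsManifold.maximalAtlas I ∞ M,
      ∀ i ≤ r, ∀ j ≤ r, ∀ C, IsCompact C → C ⊆ (e.extend I).target ×ˢ (e'.extend I).target →
        ∃ B, ∀ n, ∀ z ∈ C, ‖mixedDeriv i j (e.extend I).target (e'.extend I).target
          (inCharts I e e' (K n).1) z‖ ≤ B * a n) :
    Tendsto K atTop (𝓝 0) := by
  have h0 : 𝓝 (0 : CrrMap I M k r) = _ := nhds_iInf
  simp only [h0, nhds_iInf, tendsto_iInf, nhds_induced, tendsto_comap_iff]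
  intro e he e' he' i hi j hj
  rw [UniformOnFun.tendsto_iff_tendstoUniformlyOn]
  rintro C ⟨hC, hCt⟩
  obtain ⟨B, hB⟩ := h e he e' he' i hi j hj C hC hCt
  have h1 : mixedDeriv i j (e.extend I).target (e'.extend I).target
      (inCharts I e e' (0 : CrrMap I M k r).1) = 0 := mixedDeriv_zero i j _ _
  change TendstoUniformlyOn (fun n => mixedDeriv i j (e.extend I).target (e'.extend I).target
    (inCharts I e e' (K n).1)) (mixedDeriv i j (e.extend I).target (e'.extend I).target
      (inCharts I e e' (0 : CrrMap I M k r).1)) atTop C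
  rw [h1]
  exact tendstoUniformlyOn_zero_of_norm_le (W := EuclideanSpace ℝ (Fin m) [×i]→L[ℝ]
    EuclideanSpace ℝ (Fin m) [×j]→L[ℝ] Fin k → Fin k → ℝ) (by simpa using ha.const_mul B) hB

theorem continuous_eval [IsManifold I ∞ M] (p : M) :
    Continuous fun f : CrMap I M k r => f p := by
  refine continuous_iff_continuousAt.2 fun f₀ => ?_
  have he : chartAt H p ∈ IsManifold.maximalAtlas I ∞ M := IsManifold.chart_mem_maximalAtlas p
  have hp : p ∈ (chartAt H p).source := mem_chart_source H p
  have h := tendsto_crMap_iff.1 (tendsto_id (x := 𝓝 f₀)) _ he 0 (Nat.zero_le r)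
    {(chartAt H p).extend I p} isCompact_singleton (by
      rw [Set.singleton_subset_iff]
      exact ((chartAt H p).extend I).map_source (by simp))
  have h1 := (h.tendsto_at (Set.mem_singleton _))
  have h2 := ((continuous_eval_const (F := EuclideanSpace ℝ (Fin m) [×0]→L[ℝ]
    EuclideanSpace ℝ (Fin k)) (0 : Fin 0 → EuclideanSpace ℝ (Fin m))).tendsto _).comp h1
  simp only [iteratedFDerivWithin_zero_apply, Function.comp_def, id,
    (chartAt H p).extend_left_inv hp] at h2
  exact h2

end Topology

/-! ### Random sums of bumps, their kernels and the test functional -/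

namespace BumpSequence

variable {m : ℕ} {H : Type*} [TopologicalSpace H]
  {I : ModelWithCorners ℝ (EuclideanSpace ℝ (Fin m)) H}
  {M : Type*} [TopologicalSpace M] [ChartedSpace H M] {k r : ℕ}

theorem contDiffOn (b : BumpSequence I M r) {e : OpenPartialHomeomorph M H}
    (he : e ∈ IsManifold.maximalAtlas I ∞ M) {i : ℕ} (l : ℕ) :
    ContDiffOn ℝ i (b.toFun l ∘ (e.extend I).symm) (e.extend I).target :=
  (contDiffOn_comp_extend_symm he le_rfl (b.contMDiff l)).of_le (by exact_mod_cast le_top)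

/-- The function `∑ w_l f_l v`, the sum over `l < N`. -/
noncomputable def field (b : BumpSequence I M r) (N : ℕ) (v : EuclideanSpace ℝ (Fin k))
    (w : ℕ → ℝ) : CrMap I M k r :=
  ⟨fun p => ∑ l ∈ Finset.range N, b.toFun l p • w l • v,
    contMDiff_finsetSum fun l _ =>
      ((b.contMDiff l).of_le (by exact_mod_cast le_top)).smul contMDiff_const⟩

theorem field_apply (b : BumpSequence I M r) (N : ℕ) (v : EuclideanSpace ℝ (Fin k))
    (w : ℕ → ℝ) (p : M) : b.field N v w p = ∑ l ∈ Finset.range N, b.toFun l p • w l • v := rfl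

theorem iteratedFDerivWithin_field (b : BumpSequence I M r) (N : ℕ)
    (v : EuclideanSpace ℝ (Fin k)) (w : ℕ → ℝ) {e : OpenPartialHomeomorph M H}
    (he : e ∈ IsManifold.maximalAtlas I ∞ M) {x : EuclideanSpace ℝ (Fin m)}
    (hx : x ∈ (e.extend I).target) (i : ℕ) :
    iteratedFDerivWithin ℝ i (b.field N v w ∘ (e.extend I).symm) (e.extend I).target x =
      ∑ l ∈ Finset.range N, (iteratedFDerivWithin ℝ i (b.toFun l ∘ (e.extend I).symm)
        (e.extend I).target x).smulRight (w l • v) :=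
  iteratedFDerivWithin_sum_smul (uniqueDiffOn_extend_target e) (fun l => b.contDiffOn he l) hx _ N

/-- Only the first `N` coordinates of `w` enter, and linearly, with coefficients bounded in `C^r` on
compact sets. This yields Borel measurability of the field. -/
theorem continuous_field (b : BumpSequence I M r) (N : ℕ) (v : EuclideanSpace ℝ (Fin k)) :
    Continuous (b.field N v) := by
  refine continuous_iff_continuousAt.2 fun w₀ => tendsto_crMap_iff.2 fun e he i hi C hC hCt => ?_
  obtain ⟨B, hB⟩ := b.bound e he C hC hCt
  rw [Metric.tendstoUniformlyOn_iff]
  intro ε hε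
  have h1 : Tendsto (fun w : ℕ → ℝ => ∑ l ∈ Finset.range N, B * ‖w₀ l • v - w l • v‖) (𝓝 w₀)
      (𝓝 0) := by
    have : Continuous (fun w : ℕ → ℝ => ∑ l ∈ Finset.range N, B * ‖w₀ l • v - w l • v‖) := by
      fun_prop
    simpa using this.tendsto w₀
  filter_upwards [h1.eventually_lt_const hε] with w hw x hx
  rw [dist_eq_norm, b.iteratedFDerivWithin_field N v _ he (hCt hx),
    b.iteratedFDerivWithin_field N v _ he (hCt hx), ← Finset.sum_sub_distrib]
  refine ((norm_sum_le _ _).trans (Finset.sum_le_sum fun l _ => ?_)).trans_lt hw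
  have h2 : ∀ D : EuclideanSpace ℝ (Fin m) [×i]→L[ℝ] ℝ, D.smulRight (w₀ l • v) -
      D.smulRight (w l • v) = D.smulRight (w₀ l • v - w l • v) := fun D => by
    ext1 y
    simp [smul_sub]
  rw [h2, ContinuousMultilinearMap.norm_smulRight]
  exact mul_le_mul_of_nonneg_right (hB i hi l x hx) (norm_nonneg _)

/-- The kernel `∑ f_l(p) f_l(q) A`, the sum over `l < N`. -/
noncomputable def kernel (b : BumpSequence I M r) (N : ℕ) (A : Fin k → Fin k → ℝ) :
    CrrMap I M k r :=
  ⟨fun z => ∑ l ∈ Finset.range N, b.toFun l z.1 • b.toFun l z.2 • A, fun e he e' he' =>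
    isCrrOn_sum_smul (uniqueDiffOn_extend_target e) (uniqueDiffOn_extend_target e')
      (fun l => b.contDiffOn he l) (fun l => b.contDiffOn he' l) A N⟩

theorem tendsto_kernel (b : BumpSequence I M r) (N : ℕ → ℕ) {A : ℕ → Fin k → Fin k → ℝ}
    (hA : Tendsto A atTop (𝓝 0)) : Tendsto (fun n => b.kernel (N n) (A n)) atTop (𝓝 0) := by
  refine tendsto_crrMap_zero_of_bound (a := fun n => ‖A n‖) (by simpa using hA.norm) ?_
  intro e he e' he' i hi j hj C hC hCt
  obtain ⟨B, hB⟩ := b.bound e he (Prod.fst '' C) (hC.image continuous_fst) (by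
    rintro _ ⟨z, hz, rfl⟩
    exact (hCt hz).1)
  obtain ⟨B', hB'⟩ := b.bound e' he' (Prod.snd '' C) (hC.image continuous_snd) (by
    rintro _ ⟨z, hz, rfl⟩
    exact (hCt hz).2)
  refine ⟨B * B', fun n z hz => ?_⟩
  obtain ⟨l₀, hl₀⟩ := b.disjoint e he z.1 (hCt hz).1
  rw [mul_assoc]
  exact norm_mixedDeriv_sum_smul_le (uniqueDiffOn_extend_target e) (uniqueDiffOn_extend_target e')
    (fun l => b.contDiffOn he l) (fun l => b.contDiffOn he' l) (A n) (N n) (hCt hz)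
    (fun l => hB i hi l _ ⟨z, hz, rfl⟩) (fun l => hB' j hj l _ ⟨z, hz, rfl⟩)
    (fun l hl => hl₀ l hl i)

/-- The derivative of order `r` by which the functions of the sequence are separated. -/
noncomputable def jet (b : BumpSequence I M r) (l : ℕ) (f : CrMap I M k r) :
    EuclideanSpace ℝ (Fin k) :=
  iteratedFDerivWithin ℝ r (f ∘ (b.chart.extend I).symm) (b.chart.extend I).target (b.point l) b.vec

/-- A bounded continuous function on `C^r(M, ℝᵏ)` that measures the derivatives of order `r`. -/
noncomputable def test (b : BumpSequence I M r) (f : CrMap I M k r) : ℝ :=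
  ⨆ l, min 1 ‖b.jet l f‖

theorem bddAbove_min_jet (b : BumpSequence I M r) (f : CrMap I M k r) :
    BddAbove (Set.range fun l => min 1 ‖b.jet l f‖) :=
  ⟨1, by rintro _ ⟨l, rfl⟩; exact min_le_left _ _⟩

theorem min_jet_le_test (b : BumpSequence I M r) (f : CrMap I M k r) (l : ℕ) :
    min 1 ‖b.jet l f‖ ≤ b.test f :=
  le_ciSup (b.bddAbove_min_jet f) l

theorem test_nonneg (b : BumpSequence I M r) (f : CrMap I M k r) : 0 ≤ b.test f :=
  (le_min zero_le_one (norm_nonneg _)).trans (b.min_jet_le_test f 0)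

theorem test_le_one (b : BumpSequence I M r) (f : CrMap I M k r) : b.test f ≤ 1 :=
  ciSup_le fun _ => min_le_left _ _

theorem jet_field (b : BumpSequence I M r) {N l : ℕ} (hl : l < N) (v : EuclideanSpace ℝ (Fin k))
    (w : ℕ → ℝ) : b.jet l (b.field N v w) = b.const • w l • v := by
  rw [jet, b.iteratedFDerivWithin_field N v w b.chart_mem
    (interior_subset (b.set_subset (b.point_mem l))), sum_apply,
    Finset.sum_eq_single_of_mem l (Finset.mem_range.2 hl)]
  · rw [ContinuousMultilinearMap.smulRight_apply, b.deriv_self]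
  · intro l' _ hl'
    rw [b.deriv_other l' l hl']
    simp

theorem test_zero (b : BumpSequence I M r) : b.test (0 : CrMap I M k r) = 0 := by
  have h : ∀ l, b.jet l (0 : CrMap I M k r) = 0 := fun l => by
    have : ⇑(0 : CrMap I M k r) ∘ (b.chart.extend I).symm = fun _ => 0 := rfl
    rw [jet, this, iteratedFDerivWithin_fun_zero]
    rfl
  simp [test, h]

/-- All the points `z_l` lie in one compact set of one chart, so `C^r` convergence controls the
infinitely many jets uniformly in `l`, and with them their supremum. -/
theorem continuous_test (b : BumpSequence I M r) :
    Continuous (b.test : CrMap I M k r → ℝ) := by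
  refine continuous_iff_continuousAt.2 fun f₀ => ?_
  have h := tendsto_crMap_iff.1 (tendsto_id (x := 𝓝 f₀)) _ b.chart_mem r le_rfl b.set
    b.isCompact_set (b.set_subset.trans interior_subset)
  rw [Metric.tendstoUniformlyOn_iff] at h
  rw [ContinuousAt, Metric.tendsto_nhds]
  intro ε hε
  set c := ∏ i, ‖b.vec i‖
  have hc : 0 ≤ c := Finset.prod_nonneg fun _ _ => norm_nonneg _
  -- Evaluation on `vec` costs a factor `c`; the `+ 1` covers the case `c = 0`.
  filter_upwards [h (ε / 2 / (c + 1)) (by positivity)] with f hf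
  have hjet : ∀ l, dist (b.jet l f) (b.jet l f₀) ≤ ε / 2 := fun l => by
    have h1 := hf (b.point l) (b.point_mem l)
    rw [dist_comm, dist_eq_norm] at h1
    rw [dist_eq_norm, jet, jet, ← sub_apply]
    refine (ContinuousMultilinearMap.le_opNorm _ _).trans
      ((mul_le_mul_of_nonneg_right h1.le hc).trans ?_)
    rw [div_mul_eq_mul_div]
    exact div_le_of_le_mul₀ (by positivity) (by positivity) (by nlinarith)
  have key : ∀ f₁ f₂ : CrMap I M k r, (∀ l, dist (b.jet l f₁) (b.jet l f₂) ≤ ε / 2) →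
      b.test f₁ ≤ b.test f₂ + ε / 2 := fun f₁ f₂ h12 => by
    refine ciSup_le fun l => le_trans ?_ (add_le_add_left (b.min_jet_le_test f₂ l) _)
    have h1 : ‖b.jet l f₁‖ ≤ ‖b.jet l f₂‖ + ε / 2 := by
      have := norm_sub_norm_le (b.jet l f₁) (b.jet l f₂)
      rw [← dist_eq_norm] at this
      linarith [h12 l]
    rw [← min_add_add_right]
    exact min_le_min (by linarith) h1
  have h1 := key f f₀ hjet
  have h2 := key f₀ f fun l => by rw [dist_comm]; exact hjet l
  rw [Real.dist_eq, abs_lt]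
  constructor <;> linarith

end BumpSequence

/-! ### The covariance determines the law of the process -/

section Uniqueness

/-- The characteristic function of a Gaussian measure at a functional `L` depends only on the mean
and variance of `L`. Since `L` is a linear combination of coordinates, these come from the first and
second moments. -/
theorem gaussian_ext_of_moments {j k : ℕ} {μ ν : Measure (Fin j → EuclideanSpace ℝ (Fin k))}
    [IsGaussian μ] [IsGaussian ν] (hmean : ∀ i a, ∫ x, x i a ∂μ = ∫ x, x i a ∂ν)
    (hcov : ∀ i a i' b, ∫ x, x i a * x i' b ∂μ = ∫ x, x i a * x i' b ∂ν) : μ = ν := by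
  refine Measure.ext_of_charFunDual (funext fun L => ?_)
  set c : Fin j × Fin k → ℝ := fun s => L (Pi.single s.1 (EuclideanSpace.single s.2 1))
  have hL : ∀ x, L x = ∑ s : Fin j × Fin k, c s * x s.1 s.2 := fun x => by
    have h1 : x = ∑ s : Fin j × Fin k,
        x s.1 s.2 • (Pi.single s.1 (EuclideanSpace.single s.2 (1 : ℝ)) :
          Fin j → EuclideanSpace ℝ (Fin k)) := by
      rw [Fintype.sum_prod_type]
      ext i a
      simp [Finset.sum_apply, Pi.single_apply, apply_ite]
    conv_lhs => rw [h1]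
    simp only [map_sum, map_smul, smul_eq_mul]
    exact Finset.sum_congr rfl fun s _ => mul_comm _ _
  let pr : Fin j × Fin k → StrongDual ℝ (Fin j → EuclideanSpace ℝ (Fin k)) := fun s =>
    (EuclideanSpace.proj s.2 : EuclideanSpace ℝ (Fin k) →L[ℝ] ℝ).comp
      (ContinuousLinearMap.proj s.1)
  have hm : ∀ (ρ : Measure (Fin j → EuclideanSpace ℝ (Fin k))) [IsGaussian ρ],
      ∫ x, L x ∂ρ = ∑ s, c s * ∫ x, x s.1 s.2 ∂ρ := fun ρ _ => by
    have hi : ∀ s : Fin j × Fin k,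
        Integrable (fun x : Fin j → EuclideanSpace ℝ (Fin k) => x s.1 s.2) ρ := fun s =>
      IsGaussian.integrable_dual ρ (pr s)
    simp only [hL]
    rw [integral_finsetSum _ fun s _ => (hi s).const_mul (c s)]
    simp only [integral_const_mul]
  have hv : ∀ (ρ : Measure (Fin j → EuclideanSpace ℝ (Fin k))) [IsGaussian ρ],
      ∫ x, L x ^ 2 ∂ρ = ∑ s, ∑ t, c s * c t * ∫ x, x s.1 s.2 * x t.1 t.2 ∂ρ := fun ρ _ => by
    have hi : ∀ s t : Fin j × Fin k, Integrable
        (fun x : Fin j → EuclideanSpace ℝ (Fin k) => x s.1 s.2 * x t.1 t.2) ρ := fun s t =>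
      (IsGaussian.memLp_dual ρ (pr s) 2 (by simp)).integrable_mul
        (IsGaussian.memLp_dual ρ (pr t) 2 (by simp))
    have h2 : ∀ x, L x ^ 2 = ∑ s, ∑ t, c s * c t * (x s.1 s.2 * x t.1 t.2) := fun x => by
      rw [hL, sq, Finset.sum_mul_sum]
      exact Finset.sum_congr rfl fun s _ => Finset.sum_congr rfl fun t _ => by ring
    simp only [h2]
    rw [integral_finsetSum _ fun s _ => integrable_finsetSum _ fun t _ => (hi s t).const_mul _]
    refine Finset.sum_congr rfl fun s _ => ?_
    rw [integral_finsetSum _ fun t _ => (hi s t).const_mul _]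
    simp only [integral_const_mul]
  have hm' : ∫ x, L x ∂μ = ∫ x, L x ∂ν := by
    rw [hm, hm]
    exact Finset.sum_congr rfl fun s _ => by rw [hmean]
  have hv' : ∫ x, L x ^ 2 ∂μ = ∫ x, L x ^ 2 ∂ν := by
    rw [hv, hv]
    exact Finset.sum_congr rfl fun s _ => Finset.sum_congr rfl fun t _ => by rw [hcov]
  have hvar : Var[L; μ] = Var[L; ν] := by
    rw [variance_eq_sub (IsGaussian.memLp_dual μ L 2 (by simp)),
      variance_eq_sub (IsGaussian.memLp_dual ν L 2 (by simp)), hm']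
    exact congrArg (· - _) hv'
  rw [IsGaussian.charFunDual_eq, IsGaussian.charFunDual_eq, hvar, integral_complex_ofReal,
    integral_complex_ofReal, hm']

variable {m : ℕ} {H : Type*} [TopologicalSpace H]
  {I : ModelWithCorners ℝ (EuclideanSpace ℝ (Fin m)) H}
  {M : Type*} [TopologicalSpace M] [ChartedSpace H M] {k r : ℕ}
  {Ω : Type*} [MeasurableSpace Ω] {P : Measure Ω} {X : Ω → CrMap I M k r}
  {Ω' : Type*} [MeasurableSpace Ω'] {P' : Measure Ω'} {X' : Ω' → CrMap I M k r}

theorem IsGaussianField.integrable (hX : IsGaussianField P X) (p : M) :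
    Integrable (fun w => X w p) P := by
  have := hX.gaussian 1 fun _ => p
  have h : HasGaussianLaw (fun w (_ : Fin 1) => X w p) P := IsGaussian.hasGaussianLaw
  exact (h.eval 0).integrable

theorem IsGaussianField.integral_apply_eq_zero (hX : IsGaussianField P X) (p : M) (a : Fin k) :
    ∫ w, X w p a ∂P = 0 := by
  have h := (EuclideanSpace.proj a : EuclideanSpace ℝ (Fin k) →L[ℝ] ℝ).integral_comp_comm
    (hX.integrable p)
  rw [hX.centered, map_zero] at h
  exact h

variable [IsManifold I ∞ M]

theorem IsGaussianField.measurable_eval (hX : IsGaussianField P X) (p : M) :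
    Measurable fun w => X w p :=
  (continuous_eval p).measurable.comp hX.measurable

theorem IsGaussianField.measurable_eval_fin (hX : IsGaussianField P X) {j : ℕ} (p : Fin j → M) :
    Measurable fun w i => X w (p i) :=
  measurable_pi_lambda _ fun i => hX.measurable_eval (p i)

/-- The law of a Gaussian field, as a process, is determined by its covariance function. -/
theorem IsGaussianField.map_eval_eq (hX : IsGaussianField P X) (hX' : IsGaussianField P' X')
    (h : covarianceFun P X = covarianceFun P' X') :
    P.map (fun w (p : M) => X w p) = P'.map (fun w (p : M) => X' w p) := by
  have hmX : Measurable fun w (p : M) => X w p := measurable_pi_lambda _ hX.measurable_eval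
  have hmX' : Measurable fun w (p : M) => X' w p := measurable_pi_lambda _ hX'.measurable_eval
  have hfin : ∀ (j : ℕ) (p : Fin j → M),
      P.map (fun w i => X w (p i)) = P'.map (fun w i => X' w (p i)) := fun j p => by
    have := hX.gaussian j p
    have := hX'.gaussian j p
    have hc : ∀ i a, ∀ (Q : Measure (Fin j → EuclideanSpace ℝ (Fin k))),
        AEStronglyMeasurable (fun x : Fin j → EuclideanSpace ℝ (Fin k) => x i a) Q :=
      fun i a Q => (Continuous.measurable (by fun_prop)).aestronglyMeasurable
    have hc' : ∀ i a i' b, ∀ (Q : Measure (Fin j → EuclideanSpace ℝ (Fin k))),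
        AEStronglyMeasurable (fun x : Fin j → EuclideanSpace ℝ (Fin k) => x i a * x i' b) Q :=
      fun i a i' b Q => (Continuous.measurable (by fun_prop)).aestronglyMeasurable
    refine gaussian_ext_of_moments (fun i a => ?_) fun i a i' b => ?_
    · rw [integral_map (hX.measurable_eval_fin p).aemeasurable (hc _ _ _),
        integral_map (hX'.measurable_eval_fin p).aemeasurable (hc _ _ _), 
          hX.integral_apply_eq_zero, hX'.integral_apply_eq_zero]
    · rw [integral_map (hX.measurable_eval_fin p).aemeasurable (hc' _ _ _ _ _),
        integral_map (hX'.measurable_eval_fin p).aemeasurable (hc' _ _ _ _ _)]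
      exact congrFun (congrFun (congrFun h (p i, p i')) a) b
  have hproj : IsProjectiveLimit (P'.map (fun w (p : M) => X' w p))
      (fun J : Finset M => (P.map (fun w (p : M) => X w p)).map J.restrict) := fun J => by
    change _ = (P.map (fun w (p : M) => X w p)).map J.restrict
    rw [Measure.map_map (Finset.measurable_restrict J) hmX,
      Measure.map_map (Finset.measurable_restrict J) hmX']
    -- Gaussianity is given for families indexed by `Fin j`, so the finite set `J` is enumerated.
    have hre : Measurable fun (x : Fin J.card → EuclideanSpace ℝ (Fin k)) (q : J) =>
        x (J.equivFin q) := measurable_pi_lambda _ fun q => measurable_pi_apply _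
    have h1 := congrArg (Measure.map fun (x : Fin J.card → EuclideanSpace ℝ (Fin k)) (q : J) =>
      x (J.equivFin q)) (hfin J.card fun i => J.equivFin.symm i)
    rw [Measure.map_map hre (hX.measurable_eval_fin _),
      Measure.map_map hre (hX'.measurable_eval_fin _)] at h1
    simpa [Function.comp_def, Finset.restrict_def] using h1.symm
  have : IsProbabilityMeasure P := by
    -- A Gaussian law is a probability measure; the empty family of points already shows that `P` is
    -- one.
    have := hX.gaussian 0 Fin.elim0
    exact Measure.isProbabilityMeasure_of_map fun w (i : Fin 0) => X w (Fin.elim0 i)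
  exact IsProjectiveLimit.unique (fun J => rfl) hproj

/-- The law of a Gaussian field is a Gaussian measure with the same covariance. -/
theorem IsGaussianField.id_map (hX : IsGaussianField P X) : IsGaussianField (P.map X) id where
  measurable := measurable_id
  gaussian j p := by
    change IsGaussian ((P.map X).map fun f i => f (p i))
    rw [Measure.map_map (measurable_pi_lambda _ fun i => (continuous_eval (p i)).measurable)
      hX.measurable]
    exact hX.gaussian j p
  centered p := by
    change ∫ f, f p ∂P.map X = 0
    rw [integral_map hX.measurable.aemeasurable
      (continuous_eval (r := r) (k := k) (I := I) p).measurable.aestronglyMeasurable]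
    exact hX.centered p

theorem IsGaussianField.covarianceFun_id_map (hX : IsGaussianField P X) :
    covarianceFun (P.map X) id = covarianceFun P X := by
  funext z a b
  have hc : ∀ p a, Measurable fun f : CrMap I M k r => f p a := fun p a =>
    (EuclideanSpace.proj a : EuclideanSpace ℝ (Fin k) →L[ℝ] ℝ).continuous.measurable.comp
      (continuous_eval p).measurable
  exact integral_map hX.measurable.aemeasurable ((hc z.1 a).mul (hc z.2 b)).aestronglyMeasurable

end Uniqueness

/-! ### Cylinder measurability of the test functional -/

section Cylinder

variable {m : ℕ} {H : Type*} [TopologicalSpace H]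
  {I : ModelWithCorners ℝ (EuclideanSpace ℝ (Fin m)) H}
  {M : Type*} [TopologicalSpace M] [ChartedSpace H M] {k r : ℕ}

/-- Derivatives at interior points are measurable functions of the values of the field. -/
theorem measurable_iteratedFDerivWithin {α : Type*} [MeasurableSpace α] {X : α → CrMap I M k r}
    (hX : ∀ p, Measurable fun w => X w p) {e : OpenPartialHomeomorph M H}
    (he : e ∈ IsManifold.maximalAtlas I ∞ M) {i : ℕ} (hi : i ≤ r) {y : EuclideanSpace ℝ (Fin m)}
    (hy : y ∈ interior (e.extend I).target) (V : Fin i → EuclideanSpace ℝ (Fin m)) :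
    Measurable fun w =>
      iteratedFDerivWithin ℝ i (X w ∘ (e.extend I).symm) (e.extend I).target y V := by
  induction i generalizing y with
  | zero => exact hX _
  | succ i ih =>
    have hsmul : Tendsto (fun n : ℕ => ‖(n : ℝ)‖) atTop atTop := by
      simpa using tendsto_natCast_atTop_atTop (R := ℝ)
    have hev : ∀ᶠ n : ℕ in atTop, y + (n : ℝ)⁻¹ • V 0 ∈ interior (e.extend I).target := by
      have h1 : Tendsto (fun n : ℕ => y + (n : ℝ)⁻¹ • V 0) atTop (𝓝 y) := by
        simpa using tendsto_const_nhds.add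
          ((tendsto_inv_atTop_nhds_zero_nat (𝕜 := ℝ)).smul_const (V 0))
      exact h1.eventually (isOpen_interior.mem_nhds hy)
    -- Shifting the sequence by `n₀` keeps every difference quotient at interior points, where the
    -- induction hypothesis applies.
    obtain ⟨n₀, hn₀⟩ := eventually_atTop.1 hev
    refine measurable_of_tendsto_metrizable (f := fun (n : ℕ) w => ((n + n₀ : ℕ) : ℝ) •
      (iteratedFDerivWithin ℝ i (X w ∘ (e.extend I).symm) (e.extend I).target
        (y + ((n + n₀ : ℕ) : ℝ)⁻¹ • V 0) (Fin.tail V) -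
      iteratedFDerivWithin ℝ i (X w ∘ (e.extend I).symm) (e.extend I).target y (Fin.tail V)))
      (fun n => ((ih (by omega) (hn₀ (n + n₀) (by omega)) (Fin.tail V)).fun_sub
        (ih (by omega) hy (Fin.tail V))).fun_const_smul _)
      (tendsto_pi_nhds.2 fun w => ?_)
    have hd := ((contDiffOn_comp_extend_symm he (by exact_mod_cast le_top)
      (X w).contMDiff).differentiableOn_iteratedFDerivWithin (m := i)
        (by exact_mod_cast Nat.lt_of_succ_le hi) (uniqueDiffOn_extend_target e) y
        (interior_subset hy)).hasFDerivWithinAt.hasFDerivAt (mem_interior_iff_mem_nhds.1 hy)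
    have h1 := (hd.lim (V 0) hsmul).comp (tendsto_add_atTop_nat n₀)
    have h2 := ((continuous_eval_const (F := EuclideanSpace ℝ (Fin m) [×i]→L[ℝ]
      EuclideanSpace ℝ (Fin k)) (Fin.tail V)).tendsto _).comp h1
    exact h2

namespace BumpSequence

theorem measurable_test_comp (b : BumpSequence I M r) {α : Type*} [MeasurableSpace α]
    {X : α → CrMap I M k r} (hX : ∀ p, Measurable fun w => X w p) :
    Measurable fun w => b.test (X w) :=
  Measurable.iSup fun l => measurable_const.min
    (measurable_iteratedFDerivWithin hX b.chart_mem le_rfl (b.set_subset (b.point_mem l)) _).norm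

/-- Equal covariances give equal laws on cylinder sets. As `test` is measurable for the cylinder
σ-algebra, no comparison of the two laws on all Borel sets is needed. -/
theorem integral_test_eq [IsManifold I ∞ M] (b : BumpSequence I M r)
    {Ω : Type*} [MeasurableSpace Ω] {P : Measure Ω} {X : Ω → CrMap I M k r}
    {Ω' : Type*} [MeasurableSpace Ω'] {P' : Measure Ω'} {X' : Ω' → CrMap I M k r}
    (hX : IsGaussianField P X) (hX' : IsGaussianField P' X')
    (h : covarianceFun P X = covarianceFun P' X') :
    ∫ w, b.test (X w) ∂P = ∫ w, b.test (X' w) ∂P' := by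
  have hev := hX.map_eval_eq hX' h
  have hm : Measurable fun w => b.test (X w) := b.measurable_test_comp hX.measurable_eval
  have hm' : Measurable fun w => b.test (X' w) := b.measurable_test_comp hX'.measurable_eval
  have hlaw : P.map (fun w => b.test (X w)) = P'.map (fun w => b.test (X' w)) := by
    ext B hB
    -- The space `C^r(M, ℝᵏ)` carries here the σ-algebra generated by evaluations instead of the
    -- Borel one, so preimages under `test` are pulled back from the product space.
    have h1 := @measurable_test_comp _ _ _ _ _ _ _ k _ b (CrMap I M k r)
      (MeasurableSpace.comap (fun f (p : M) => f p) MeasurableSpace.pi) id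
      (fun p => (measurable_pi_apply p).comp (comap_measurable _))
    obtain ⟨S, hS, hSB⟩ := h1 hB
    rw [Measure.map_apply hm hB, Measure.map_apply hm' hB]
    have h2 : (fun w => b.test (X w)) ⁻¹' B = (fun w (p : M) => X w p) ⁻¹' S := by
      ext w
      exact (Set.ext_iff.1 hSB (X w)).symm
    have h3 : (fun w => b.test (X' w)) ⁻¹' B = (fun w (p : M) => X' w p) ⁻¹' S := by
      ext w
      exact (Set.ext_iff.1 hSB (X' w)).symm
    rw [h2, h3, ← Measure.map_apply (measurable_pi_lambda _ hX.measurable_eval) hS,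
      ← Measure.map_apply (measurable_pi_lambda _ hX'.measurable_eval) hS, hev]
  calc ∫ w, b.test (X w) ∂P = ∫ x, x ∂P.map (fun w => b.test (X w)) :=
        (integral_map hm.aemeasurable aestronglyMeasurable_id).symm
    _ = ∫ w, b.test (X' w) ∂P' := by
        rw [hlaw]
        exact integral_map hm'.aemeasurable aestronglyMeasurable_id

end BumpSequence

end Cylinder

/-! ### Independent standard Gaussian variables -/

section WhiteNoise

/-- The law of a sequence of independent standard Gaussian variables. -/
noncomputable def whiteNoise : Measure (ℕ → ℝ) :=
  Measure.infinitePi fun _ => gaussianReal 0 1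

instance : IsProbabilityMeasure whiteNoise := by
  unfold whiteNoise
  infer_instance

theorem whiteNoise_map_eval (l : ℕ) : whiteNoise.map (fun w => w l) = gaussianReal 0 1 :=
  Measure.infinitePi_map_eval _ l

theorem hasGaussianLaw_whiteNoise (l : ℕ) : HasGaussianLaw (fun w : ℕ → ℝ => w l) whiteNoise :=
  ⟨by rw [whiteNoise_map_eval]; infer_instance⟩

theorem iIndepFun_whiteNoise : iIndepFun (fun (l : ℕ) (w : ℕ → ℝ) => w l) whiteNoise :=
  iIndepFun_infinitePi (X := fun _ x => x) fun _ => measurable_id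

theorem integral_whiteNoise (l : ℕ) : ∫ w, w l ∂whiteNoise = 0 := by
  have h := integral_map (μ := whiteNoise) (φ := fun w => w l) (f := fun x : ℝ => x)
    (measurable_pi_apply l).aemeasurable aestronglyMeasurable_id
  rw [whiteNoise_map_eval, integral_id_gaussianReal] at h
  exact h.symm

theorem integral_mul_whiteNoise (l l' : ℕ) :
    ∫ w, w l * w l' ∂whiteNoise = if l = l' then 1 else 0 := by
  split_ifs with h
  · subst h
    have h1 := variance_eq_sub (hasGaussianLaw_whiteNoise l).memLp_two
    have h2 : Var[fun w : ℕ → ℝ => w l; whiteNoise] = 1 := by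
      have h3 := variance_map (X := fun x : ℝ => x) (μ := whiteNoise) (Y := fun w => w l)
        measurable_id.aemeasurable (measurable_pi_apply l).aemeasurable
      rw [whiteNoise_map_eval, variance_fun_id_gaussianReal] at h3
      exact h3.symm
    rw [h2, integral_whiteNoise] at h1
    simp only [← sq]
    simpa using h1.symm
  · have h1 := (iIndepFun_whiteNoise.indepFun h).integral_fun_mul_eq_mul_integral
      (measurable_pi_apply l).aestronglyMeasurable (measurable_pi_apply l').aestronglyMeasurable
    rw [h1, integral_whiteNoise, zero_mul]

/-- The maximum of many independent standard Gaussian variables is large. -/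
theorem exists_half_le_whiteNoise (t : ℝ) :
    ∃ N : ℕ, 1 / 2 ≤ whiteNoise.real {w | ∃ l < N, t ≤ |w l|} := by
  set p := gaussianReal 0 1 {x : ℝ | |x| < t}
  have hmeas : MeasurableSet {x : ℝ | |x| < t} := measurableSet_lt measurable_norm measurable_const
  have hp : p < 1 := by
    -- A Gaussian null set is Lebesgue null, but this complement contains the half-line `(|t|, ∞)`.
    have h1 : gaussianReal 0 1 {x : ℝ | |x| < t}ᶜ ≠ 0 := fun h => by
      have h2 := gaussianReal_absolutelyContinuous' 0 one_ne_zero h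
      have h3 : Set.Ioi (|t|) ⊆ {x : ℝ | |x| < t}ᶜ := fun x hx =>
        not_lt.2 ((le_abs_self t).trans ((Set.mem_Ioi.1 hx).le.trans (le_abs_self x)))
      have h4 := measure_mono_null h3 h2
      simp at h4
    rw [prob_compl_eq_one_sub hmeas] at h1
    exact lt_of_not_ge fun h => h1 (tsub_eq_zero_of_le h)
  obtain ⟨N, hN⟩ := ((ENNReal.tendsto_pow_atTop_nhds_zero_of_lt_one hp).eventually_lt_const
    (show (0 : ENNReal) < 2⁻¹ by simp)).exists
  refine ⟨N, ?_⟩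
  have hset : {w : ℕ → ℝ | ∃ l < N, t ≤ |w l|} =
      ((Finset.range N : Set ℕ).pi fun _ => {x : ℝ | |x| < t})ᶜ := by
    ext w
    simp [Set.mem_pi]
  have hpi : whiteNoise ((Finset.range N : Set ℕ).pi fun _ => {x : ℝ | |x| < t}) = p ^ N := by
    rw [whiteNoise, Measure.infinitePi_pi _ fun _ _ => hmeas]
    simp [p]
  have hm : MeasurableSet ((Finset.range N : Set ℕ).pi fun _ => {x : ℝ | |x| < t}) :=
    MeasurableSet.pi (Finset.countable_toSet _) fun _ _ => hmeas
  rw [hset, probReal_compl_eq_one_sub hm, measureReal_def, hpi]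
  have h5 : (p ^ N).toReal ≤ (2⁻¹ : ENNReal).toReal :=
    ENNReal.toReal_mono (by simp) hN.le
  have h6 : (2⁻¹ : ENNReal).toReal = 1 / 2 := by simp
  linarith

end WhiteNoise

/-! ### The Gaussian fields of the counterexample -/

section Main

variable {m : ℕ} {H : Type*} [TopologicalSpace H]
  {I : ModelWithCorners ℝ (EuclideanSpace ℝ (Fin m)) H}
  {M : Type*} [TopologicalSpace M] [ChartedSpace H M] {k r : ℕ}

namespace BumpSequence

theorem isGaussianField_field (b : BumpSequence I M r) (N : ℕ) (v : EuclideanSpace ℝ (Fin k)) :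
    IsGaussianField whiteNoise (b.field N v) where
  measurable := (b.continuous_field N v).measurable
  gaussian j p := by
    have h1 : HasGaussianLaw (fun (w : ℕ → ℝ) (l : Fin N) => w l) whiteNoise :=
      iIndepFun.hasGaussianLaw (X := fun (l : Fin N) (w : ℕ → ℝ) => w l)
        (fun l => hasGaussianLaw_whiteNoise l) (iIndepFun_whiteNoise.precomp Fin.val_injective)
    let L : (Fin N → ℝ) →L[ℝ] Fin j → EuclideanSpace ℝ (Fin k) :=
      ContinuousLinearMap.pi fun i => ∑ l : Fin N, b.toFun l (p i) •
        (ContinuousLinearMap.proj l : (Fin N → ℝ) →L[ℝ] ℝ).smulRight v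
    have h2 : (fun (w : ℕ → ℝ) i => b.field N v w (p i)) = fun w => L fun l => w l := by
      funext w i
      simp [L, field_apply, Finset.sum_range]
    rw [h2]
    exact (h1.map_fun L).isGaussian_map
  centered p := by
    simp only [field_apply]
    have hi : ∀ l, Integrable (fun w : ℕ → ℝ => b.toFun l p • w l • v) whiteNoise := fun l =>
      (((hasGaussianLaw_whiteNoise l).integrable).smul_const v).smul (b.toFun l p)
    rw [integral_finsetSum _ fun l _ => hi l]
    refine Finset.sum_eq_zero fun l _ => ?_
    rw [integral_smul, integral_smul_const, integral_whiteNoise, zero_smul, smul_zero]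

/-- In the double sum for the product of two values, orthonormality of the `w_l` leaves only the
diagonal. -/
theorem covarianceFun_field (b : BumpSequence I M r) (N : ℕ) (v : EuclideanSpace ℝ (Fin k)) :
    covarianceFun whiteNoise (b.field N v) = (b.kernel N fun a a' => v a * v a').1 := by
  funext z a a'
  have h1 : ∀ (w : ℕ → ℝ) p (a : Fin k), b.field N v w p a =
      ∑ l ∈ Finset.range N, b.toFun l p * (w l * v a) := fun w p a => by
    simp [field_apply]
  have hi : ∀ l l', Integrable (fun w : ℕ → ℝ => w l * w l') whiteNoise := fun l l' =>
    (hasGaussianLaw_whiteNoise l).memLp_two.integrable_mul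
      (hasGaussianLaw_whiteNoise l').memLp_two
  have h2 : ∀ w : ℕ → ℝ, b.field N v w z.1 a * b.field N v w z.2 a' =
      ∑ l ∈ Finset.range N, ∑ l' ∈ Finset.range N,
        b.toFun l z.1 * b.toFun l' z.2 * (v a * v a') * (w l * w l') := fun w => by
    rw [h1, h1, Finset.sum_mul_sum]
    exact Finset.sum_congr rfl fun l _ => Finset.sum_congr rfl fun l' _ => by ring
  simp only [covarianceFun, h2]
  rw [integral_finsetSum _ fun l _ => integrable_finsetSum _ fun l' _ => (hi l l').const_mul _]
  simp only [kernel, Finset.sum_apply, Pi.smul_apply, smul_eq_mul]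
  refine Finset.sum_congr rfl fun l hl => ?_
  rw [integral_finsetSum _ fun l' _ => (hi l l').const_mul _]
  simp only [integral_const_mul, integral_mul_whiteNoise]
  rw [Finset.sum_eq_single_of_mem l hl fun l' _ h => by rw [if_neg h.symm, mul_zero]]
  rw [if_pos rfl]
  ring

theorem field_zero (b : BumpSequence I M r) (v : EuclideanSpace ℝ (Fin k)) (w : ℕ → ℝ) :
    b.field 0 v w = 0 := rfl

theorem exists_half_le_integral_test (b : BumpSequence I M r)
    {v : EuclideanSpace ℝ (Fin k)} (hv : v ≠ 0) :
    ∃ N : ℕ, 1 / 2 ≤ ∫ w, b.test (b.field N v w) ∂whiteNoise := by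
  have hc : 0 < |b.const| * ‖v‖ := mul_pos (abs_pos.2 b.const_ne_zero) (norm_pos_iff.2 hv)
  obtain ⟨N, hN⟩ := exists_half_le_whiteNoise (|b.const| * ‖v‖)⁻¹
  refine ⟨N, hN.trans ?_⟩
  have hmeas : Measurable fun w => b.test (b.field N v w) :=
    b.continuous_test.measurable.comp (b.continuous_field N v).measurable
  have hint : Integrable (fun w => b.test (b.field N v w)) whiteNoise :=
    Integrable.of_bound hmeas.aestronglyMeasurable 1 (Eventually.of_forall fun w => by
      rw [Real.norm_of_nonneg (b.test_nonneg _)]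
      exact b.test_le_one _)
  set S := {w : ℕ → ℝ | ∃ l < N, (|b.const| * ‖v‖)⁻¹ ≤ |w l|}
  have hS : MeasurableSet S := by
    have : S = ⋃ l, ⋃ (_ : l < N), {w : ℕ → ℝ | (|b.const| * ‖v‖)⁻¹ ≤ |w l|} := by
      ext w
      simp [S]
    rw [this]
    exact MeasurableSet.iUnion fun l => MeasurableSet.iUnion fun _ =>
      measurableSet_le measurable_const (measurable_pi_apply l).norm
  rw [← integral_indicator_one hS]
  refine integral_mono ((integrable_const 1).indicator hS) hint fun w => ?_
  refine Set.indicator_le' (fun w hw => ?_) (fun w _ => b.test_nonneg _) w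
  obtain ⟨l, hl, hlw⟩ := hw
  refine le_trans ?_ (b.min_jet_le_test _ l)
  rw [b.jet_field hl, norm_smul, norm_smul, Real.norm_eq_abs, Real.norm_eq_abs]
  refine le_min le_rfl ?_
  rw [inv_le_iff_one_le_mul₀ hc] at hlw
  calc (1 : ℝ) ≤ |w l| * (|b.const| * ‖v‖) := hlw
    _ = _ := by ring

theorem not_tendsto_of_half_le (b : BumpSequence I M r)
    {μ : ℕ → ProbabilityMeasure (CrMap I M k r)} {ν : ProbabilityMeasure (CrMap I M k r)}
    (hμ : ∀ n, 1 / 2 ≤ ∫ f, b.test f ∂(μ n : Measure (CrMap I M k r)))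
    (hν : ∫ f, b.test f ∂(ν : Measure (CrMap I M k r)) = 0) : ¬ Tendsto μ atTop (𝓝 ν) := by
  intro h
  let F : BoundedContinuousFunction (CrMap I M k r) ℝ :=
    BoundedContinuousFunction.ofNormedAddCommGroup b.test b.continuous_test 1 fun f => by
      rw [Real.norm_of_nonneg (b.test_nonneg _)]
      exact b.test_le_one _
  have h1 := ProbabilityMeasure.tendsto_iff_forall_integral_tendsto.1 h F
  have h2 : ∫ f, F f ∂(ν : Measure (CrMap I M k r)) = 0 := hν
  rw [h2] at h1
  have := ge_of_tendsto' h1 hμ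
  norm_num at this

end BumpSequence

end Main

end GRF

/-! ### Conclusion -/

theorem mainTheorem6 {m k : ℕ} (hm : 0 < m) (hk : 0 < k) (r : ℕ)
    {H : Type*} [TopologicalSpace H]
    (I : ModelWithCorners ℝ (EuclideanSpace ℝ (Fin m)) H)
    (M : Type*) [TopologicalSpace M] [ChartedSpace H M] [IsManifold I ∞ M]
    [T2Space M] [SecondCountableTopology M] [Nonempty M] :
    (∀ inv : GRF.CovarianceImage I M k r → GRF.GaussianMeasure I M k r,
      (∀ K : GRF.CovarianceImage I M k r, GRF.covarianceOf (inv K) = K.1.1) →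
        ¬ Continuous inv) ∧
    (∃ (Ω : Type) (_ : MeasurableSpace Ω) (P : Measure Ω) (_ : IsProbabilityMeasure P)
      (X : ℕ → Ω → GRF.CrMap I M k r) (K : ℕ → GRF.CrrMap I M k r),
      (∀ n, GRF.IsGaussianField P (X n)) ∧
      (∀ n, GRF.covarianceFun P (X n) = (K n).1) ∧
      Tendsto K atTop (𝓝 0) ∧
      ¬ TendstoInDistribution X atTop (fun _ => (0 : GRF.CrMap I M k r)) (fun _ => P) P) := by
  obtain ⟨b⟩ := GRF.exists_bumpSequence I M hm r
  let v : ℕ → EuclideanSpace ℝ (Fin k) := fun n =>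
    ((n : ℝ) + 1)⁻¹ • EuclideanSpace.single ⟨0, hk⟩ 1
  have hv0 : ∀ n, v n ≠ 0 := fun n => smul_ne_zero (by positivity) (by simp)
  have hv : Tendsto v atTop (𝓝 0) := by
    simpa [one_div] using (tendsto_one_div_add_atTop_nhds_zero_nat (𝕜 := ℝ)).smul_const
      (EuclideanSpace.single (⟨0, hk⟩ : Fin k) (1 : ℝ))
  have hA : Tendsto (fun n a a' => v n a * v n a') atTop (𝓝 (0 : Fin k → Fin k → ℝ)) := by
    have hc : Continuous fun (u : EuclideanSpace ℝ (Fin k)) (a a' : Fin k) => u a * u a' := by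
      fun_prop
    have h0 : (fun a a' => (0 : EuclideanSpace ℝ (Fin k)) a * (0 : EuclideanSpace ℝ (Fin k)) a') =
        (0 : Fin k → Fin k → ℝ) := by
      funext a a'
      simp
    have h1 := (hc.tendsto 0).comp hv
    rw [h0] at h1
    exact h1
  -- The number of terms is chosen after `v n`; the kernel estimate is uniform in it, so nothing
  -- ties its growth to the decay of `v n`.
  choose N hN using fun n => b.exists_half_le_integral_test (hv0 n)
  have hK := b.tendsto_kernel N hA
  have hX := fun n => b.isGaussianField_field (N n) (v n)
  have hcov := fun n => b.covarianceFun_field (N n) (v n)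
  refine ⟨fun inv hinv hcont => ?_, ℕ → ℝ, inferInstance, GRF.whiteNoise, inferInstance,
    fun n => b.field (N n) (v n), _, hX, hcov, hK, fun h => ?_⟩
  · have himage : ∀ (N' : ℕ) (v' : EuclideanSpace ℝ (Fin k)), ∃ μ : GRF.GaussianMeasure I M k r,
        GRF.covarianceOf μ = (b.kernel N' fun a a' => v' a * v' a').1 := fun N' v' => by
      have hX' := b.isGaussianField_field N' v'
      refine ⟨⟨⟨GRF.whiteNoise.map (b.field N' v'),
        Measure.isProbabilityMeasure_map hX'.measurable.aemeasurable⟩, hX'.id_map⟩, ?_⟩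
      rw [← b.covarianceFun_field]
      exact hX'.covarianceFun_id_map
    have htest : ∀ N' v', ∫ f, b.test f
        ∂((inv ⟨_, himage N' v'⟩).1 : Measure (GRF.CrMap I M k r)) =
          ∫ w, b.test (b.field N' v' w) ∂GRF.whiteNoise := fun N' v' =>
      b.integral_test_eq (inv ⟨_, himage N' v'⟩).2 (b.isGaussianField_field N' v')
        ((hinv _).trans (b.covarianceFun_field N' v').symm)
    -- The kernel with no terms is the zero kernel, realised by the zero field, so the limit point
    -- lies in the image and its expectation of `test` is that of the zero field.
    refine b.not_tendsto_of_half_le (μ := fun n => (inv ⟨_, himage (N n) (v n)⟩).1)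
      (ν := (inv ⟨_, himage 0 0⟩).1) (fun n => (hN n).trans (htest _ _).ge) ?_ ?_
    · rw [htest]
      simp only [b.field_zero, b.test_zero, integral_zero]
    · refine (continuous_subtype_val.tendsto _).comp ((hcont.tendsto _).comp ?_)
      exact tendsto_subtype_rng.2 hK
  · have hint : ∀ Y : (ℕ → ℝ) → GRF.CrMap I M k r, Measurable Y →
        ∫ f, b.test f ∂(GRF.whiteNoise.map Y) = ∫ w, b.test (Y w) ∂GRF.whiteNoise := fun Y hY =>
      integral_map hY.aemeasurable b.continuous_test.measurable.aestronglyMeasurable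
    refine b.not_tendsto_of_half_le (fun n => ?_) ?_ h.tendsto
    · exact (hN n).trans (hint _ (hX n).measurable).ge
    · refine (hint _ measurable_const).trans ?_
      simp only [b.test_zero, integral_zero]
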